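/- Use the Fourier transform $\widehat f(\xi)=\int_{\mathbb R^d}e^{-2\pi i x\cdot\xi}f(x)\,dx$, let $\mathbb B$ be the unit ball of $\mathbb R^d$ centered at the origin, let $|\cdot|$ denote Lebesgue measure, and for $q\in(2,\infty)$ with conjugate exponent $p$ (so $1/p+1/q=1$) put $$\mathbf B_{q,d}=\sup_{E}\ \sup_{|f|\le 1_E}\frac{\|\widehat f\|_q}{|E|^{1/p}},$$ where $E$ ranges over the Lebesgue measurable subsets of $\mathbb R^d$ with $0<|E|<\infty$ and $f:\mathbb R^d\to\mathbb C$ over the measurable functions with $|f|\le 1_E$. Proposition. Let $d\ge 1$. There exist constants $\tilde K>0$ and $\delta_0>0$, depending only on $d$, with the following property. Let $q\ge 4$ be an even integer with conjugate exponent $p$, let $0<\delta\le\delta_0$, and let $g$ be a real-valued measurable function such that $$(1-\delta)\,\mathbf B_{q,d}\,|\mathbb B|^{1/p}\le\big\|\widehat{e^{ig}1_{\mathbb B}}\big\|_q .$$ Then there exists an affine function $L_1:\mathbb R^d\to\mathbb R$ such that $$\int_{\mathbb B}\big|e^{iL_1(x)-ig(x)}-1\big|\,dx\le\tilde K\,\delta^{1/(8\tilde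 K)} .$$ -/

import Mathlib

open MeasureTheory FourierTransform
open scoped ENNReal

noncomputable section

/-- `Ψ_q(E) = sup_{|f| ≤ 1_E} ‖f̂‖_q / ‖1_E‖_p`, where `p` is the exponent conjugate to `q` and
`f` ranges over the Lebesgue measurable functions `ℝ^d → ℂ` with `|f| ≤ 1_E` pointwise.
The Fourier transform is `f̂(ξ) = ∫ e^{-2π i x·ξ} f(x) dx`. -/
def hyRatio (d : ℕ) (q : ℝ) (E : Set (EuclideanSpace ℝ (Fin d))) : ℝ≥0∞ :=
  ⨆ (f : EuclideanSpace ℝ (Fin d) → ℂ) (_ : AEStronglyMeasurable f volume)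
    (_ : ∀ x, ‖f x‖ ≤ E.indicator (fun _ => (1 : ℝ)) x),
    eLpNorm (𝓕 f) (ENNReal.ofReal q) volume /
      eLpNorm (E.indicator fun _ => (1 : ℝ)) (ENNReal.ofReal (Real.conjExponent q)) volume

/-- `B_{q,d} = sup_E Ψ_q(E)`, where `E` ranges over the Lebesgue measurable subsets of `ℝ^d` of
positive and finite Lebesgue measure. -/
def hyConst (d : ℕ) (q : ℝ) : ℝ≥0∞ :=
  ⨆ (E : Set (EuclideanSpace ℝ (Fin d))) (_ : NullMeasurableSet E volume)
    (_ : 0 < volume E) (_ : volume E < ⊤), hyRatio d q E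

end

/-! Testing the supremum on the ball itself shows that `e^{ig} 1_B` has nearly as large an `L^q`
norm on the Fourier side as `1_B`. For `q = 2k` this becomes physical: `∫ |f̂|^{2k}` is the value at
`0` of the `k`-fold convolution power of the autocorrelation of `f`, which is dominated pointwise by
the same object for `1_B`. Near equality must therefore hold at most places in the convolution
integral.

Write `h = e^{ig}` and let `P` and `W` be the `(k-1)`-fold powers for `h 1_B` and `1_B`. Near
equality forces `h (s + t) ≈ φ t * h s` on average, with `φ = P / W`
(`exists_lintegral_transDefect_le`). This requires `W t` to be comparable to `W 0` for all `‖t‖ ≤ 1`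
uniformly in `k`, which `exists_le_norm_autocorrPow_ballInd` supplies.

Such an approximate functional equation is stable (`exists_affine_phase_of_transDefect`). Near the
centre every small translation acts on `h` almost as a unimodular constant `c z`, and `c` is nearly
multiplicative. A large Fourier coefficient of `h` allows a modulation after which `c` is near `1`,
so its argument is single-valued and nearly additive, hence nearly linear by a Hyers–Ulam argument.
Thus `h` is close to an affine phase on a small ball, and the functional equation spreads this to
the unit ball.

The deficit entering this argument is about `q * δ`, which is useless for large `q`. When `q ≥
δ^{-1/2}` a direct argument takes over: by Plancherel `∫ |f̂|^q ≤ (sup |f̂|)^{q-2} |B|`, and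
comparison with a lower bound for the ball, which loses only a power of `q`, forces `sup |f̂| ≥ |B|
(1 - C δ^{1/4})` (`exists_le_norm_fourier_of_large_exponent`). A single nearly maximal Fourier
coefficient already gives the affine phase. The two regimes together give the rate `δ^{1/8}` with
constants independent of `q`. -/

/-! ### Functions with nonnegative Fourier transform -/

section FourierPositivity

open Filter Topology Convolution ContinuousLinearMap

variable {V : Type*} [NormedAddCommGroup V] [InnerProductSpace ℝ V] [MeasurableSpace V]
  [BorelSpace V] [FiniteDimensional ℝ V]

/-- A continuous integrable function with nonnegative Fourier transform has an integrable Fourier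
transform. -/
theorem integrable_fourier_of_nonneg {a : V → ℂ} (ha : Integrable a) (hc : Continuous a)
    {G : V → ℝ} (hG : ∀ ξ, 0 ≤ G ξ) (h : ∀ ξ, 𝓕 a ξ = (G ξ : ℂ)) : Integrable (𝓕 a) := by
  have hGc : Continuous G := by
    have : Continuous (𝓕 a) := VectorFourier.fourierIntegral_continuous
      Real.continuous_fourierChar continuous_inner ha
    have h2 : G = fun ξ => (𝓕 a ξ).re := by ext ξ; simp [h]
    rw [h2]
    exact Complex.continuous_re.comp this
  -- Gaussian-regularised Fourier inversion at the origin, with the transform moved from the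
  -- Gaussian onto `a`.
  have key : Tendsto (fun c : ℝ => ∫ w : V, Complex.exp (-(c:ℂ)⁻¹ * ‖w‖ ^ 2) • 𝓕 a w) atTop
      (𝓝 (a 0)) := by
    have := Real.tendsto_integral_gaussian_smul' ha (v := 0) hc.continuousAt
    apply this.congr'
    filter_upwards [Ioi_mem_atTop 0] with c (hc : 0 < c)
    have J : Integrable (fun w : V ↦ Complex.exp (- (c:ℂ)⁻¹ * ‖w‖ ^ 2)) := by
      have := GaussianFourier.integrable_cexp_neg_mul_sq_norm_add (V := V) (b := (c:ℂ)⁻¹)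
        (by simpa using hc) 0 0
      simpa using this
    have e := (VectorFourier.integral_fourierIntegral_smul_eq_flip (L := innerₗ V)
      Real.continuous_fourierChar continuous_inner J ha)
    have e' : ∫ w : V, 𝓕 (fun w : V ↦ Complex.exp (- (c:ℂ)⁻¹ * ‖w‖ ^ 2)) w • a w =
      ∫ w : V, Complex.exp (-(c:ℂ)⁻¹ * ‖w‖ ^ 2) • 𝓕 a w := by simpa using! e
    rw [← e']
    congr with w
    have := fourier_gaussian_innerProductSpace (V := V) (b := (c:ℂ)⁻¹) (by simpa using hc) w
    rw [this]
    congr 2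
    · congr 1
      field_simp
    · simp
      ring_nf
  have hgauss : ∀ c : ℝ, (fun w : V => Complex.exp (-(c:ℂ)⁻¹ * ‖w‖ ^ 2) • 𝓕 a w) =
      fun w => ((Real.exp (-c⁻¹ * ‖w‖ ^ 2) * G w : ℝ) : ℂ) := by
    intro c; ext w; rw [h]; push_cast; simp
  have hbd : ∀ ξ, ‖𝓕 a ξ‖ ≤ ∫ v, ‖a v‖ := fun ξ =>
    VectorFourier.norm_fourierIntegral_le_integral_norm _ _ _ _ _
  -- Since `G ≥ 0`, Fatou's lemma removes the Gaussian cutoff and bounds the mass of `G` by `a 0`.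
  have hfin : ∫⁻ w, ENNReal.ofReal (G w) ≤ ENNReal.ofReal (a 0).re := by
    have t1 : ∀ w, Tendsto (fun n : ℕ => ENNReal.ofReal (Real.exp (-(n:ℝ)⁻¹ * ‖w‖ ^ 2) * G w)) atTop
        (𝓝 (ENNReal.ofReal (G w))) := by
      intro w
      apply ENNReal.tendsto_ofReal
      have h0 : Tendsto (fun n : ℕ => -(n:ℝ)⁻¹ * ‖w‖ ^ 2) atTop (𝓝 (-0 * ‖w‖ ^ 2)) :=
        (tendsto_inv_atTop_nhds_zero_nat.neg).mul_const _
      have := ((Real.continuous_exp.tendsto _).comp h0).mul_const (G w)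
      simpa using this
    have t2 : Tendsto (fun n : ℕ => ∫⁻ w, ENNReal.ofReal (Real.exp (-(n:ℝ)⁻¹ * ‖w‖ ^ 2) * G w)) atTop
        (𝓝 (ENNReal.ofReal (a 0).re)) := by
      have := (ENNReal.continuous_ofReal.comp Complex.continuous_re).tendsto (a 0)
      have := (this.comp key).comp tendsto_natCast_atTop_atTop
      apply this.congr'
      filter_upwards [Ioi_mem_atTop 0] with n (hn : 0 < n)
      have hn' : (0:ℝ) < n := by exact_mod_cast hn
      simp only [Function.comp]
      rw [hgauss, integral_complex_ofReal, Complex.ofReal_re, ofReal_integral_eq_lintegral_ofReal]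
      · have J : Integrable (fun w : V ↦ Real.exp (- (n:ℝ)⁻¹ * ‖w‖ ^ 2)) := by
          have := GaussianFourier.integrable_cexp_neg_mul_sq_norm_add (V := V) (b := ((n:ℝ):ℂ)⁻¹)
            (by simpa using hn) 0 0
          have h2 : Integrable (fun w : V => ((Real.exp (-(n:ℝ)⁻¹ * ‖w‖ ^ 2) : ℝ) : ℂ)) :=
            this.congr (Eventually.of_forall fun w => by push_cast; simp)
          exact h2.re
        refine J.mul_bdd (c := ∫ v, ‖a v‖) hGc.aestronglyMeasurable (Eventually.of_forall ?_)
        intro w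
        have := hbd w
        rwa [h, Complex.norm_real] at this
      · exact Eventually.of_forall fun w => mul_nonneg (Real.exp_pos _).le (hG w)
    calc ∫⁻ w, ENNReal.ofReal (G w)
        = ∫⁻ w, liminf (fun n : ℕ => ENNReal.ofReal (Real.exp (-(n:ℝ)⁻¹ * ‖w‖ ^ 2) * G w)) atTop := by
          congr with w; exact (t1 w).liminf_eq.symm
      _ ≤ liminf (fun n : ℕ => ∫⁻ w, ENNReal.ofReal (Real.exp (-(n:ℝ)⁻¹ * ‖w‖ ^ 2) * G w)) atTop := by
          apply lintegral_liminf_le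
          intro n
          have : Continuous fun w : V => Real.exp (-(n:ℝ)⁻¹ * ‖w‖ ^ 2) * G w := by fun_prop
          exact this.measurable.ennreal_ofReal
      _ = _ := t2.liminf_eq
  have : 𝓕 a = fun ξ => ((G ξ : ℝ) : ℂ) := funext h
  rw [this]
  refine Integrable.ofReal ⟨hGc.aestronglyMeasurable, ?_⟩
  rw [hasFiniteIntegral_iff_ofReal (Eventually.of_forall hG)]
  exact hfin.trans_lt ENNReal.ofReal_lt_top

theorem eq_integral_of_fourier_nonneg {a : V → ℂ} (ha : Integrable a) (hc : Continuous a)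
    {G : V → ℝ} (hG : ∀ ξ, 0 ≤ G ξ) (h : ∀ ξ, 𝓕 a ξ = (G ξ : ℂ)) :
    a 0 = ((∫ ξ, G ξ : ℝ) : ℂ) := by
  have hi := integrable_fourier_of_nonneg ha hc hG h
  rw [← hc.fourierInv_fourier_eq ha hi, Real.fourierInv_eq, ← integral_complex_ofReal]
  simp [h]

/-- Inversion writes `a` as a superposition of characters with nonnegative weights, and at the
origin all of them are in phase. -/
theorem norm_le_of_fourier_nonneg {a : V → ℂ} (ha : Integrable a) (hc : Continuous a)
    {G : V → ℝ} (hG : ∀ ξ, 0 ≤ G ξ) (h : ∀ ξ, 𝓕 a ξ = (G ξ : ℂ)) (x : V) :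
    ‖a x‖ ≤ ‖a 0‖ := by
  have hi := integrable_fourier_of_nonneg ha hc hG h
  rw [eq_integral_of_fourier_nonneg ha hc hG h, Complex.norm_real,
    Real.norm_of_nonneg (integral_nonneg hG), ← hc.fourierInv_fourier_eq ha hi, Real.fourierInv_eq]
  refine (norm_integral_le_integral_norm _).trans (le_of_eq ?_)
  congr with ξ
  simp [h, abs_of_nonneg (hG ξ)]

/-- The convolution of an integrable function with a bounded one is continuous. -/
theorem continuous_convolution_of_integrable_of_bounded {f g : V → ℂ} (hf : Integrable f)
    (hg : AEStronglyMeasurable g volume) {M : ℝ} (hM : ∀ x, ‖g x‖ ≤ M) :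
    Continuous (f ⋆[mul ℂ ℂ] g) := by
  have hM0 : 0 ≤ M := (norm_nonneg _).trans (hM 0)
  have hgl : LocallyIntegrable g volume := by
    intro x
    refine ⟨Metric.ball x 1, Metric.ball_mem_nhds x one_pos, ?_⟩
    exact Measure.integrableOn_of_bounded (M := M) measure_ball_lt_top.ne hg
      (Eventually.of_forall hM)
  -- Approximating `f` in `L¹` by continuous compactly supported functions approximates the
  -- convolution uniformly, because `g` is bounded.
  refine continuous_of_uniform_approx_of_continuous fun u hu => ?_
  obtain ⟨ε, hε, hεu⟩ := Metric.mem_uniformity_dist.1 hu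
  obtain ⟨f', hs, hle, hc', hi'⟩ := hf.exists_hasCompactSupport_integral_sub_le
    (ε := ε / (2 * (M + 1))) (by positivity)
  refine ⟨f' ⋆[mul ℂ ℂ] g, hs.continuous_convolution_left _ hc' hgl, fun y => hεu ?_⟩
  have hsh : AEStronglyMeasurable (fun t => g (y - t)) volume :=
    hg.comp_quasiMeasurePreserving (quasiMeasurePreserving_sub_left volume y)
  have hint : ∀ k : V → ℂ, Integrable k → Integrable fun t => k t * g (y - t) := fun k hk =>
    hk.mul_bdd hsh (Eventually.of_forall fun t => hM _)
  rw [dist_eq_norm, convolution_mul, convolution_mul, ← integral_sub (hint f hf) (hint f' hi')]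
  calc ‖∫ t, f t * g (y - t) - f' t * g (y - t)‖
      ≤ ∫ t, ‖f t - f' t‖ * M := by
        apply norm_integral_le_of_norm_le ((hf.sub hi').norm.mul_const M)
        refine Eventually.of_forall fun t => ?_
        rw [← sub_mul, norm_mul]
        gcongr
        · exact le_rfl
        · exact hM _
    _ = (∫ t, ‖f t - f' t‖) * M := integral_mul_const _ _
    _ ≤ ε / (2 * (M + 1)) * M := by gcongr
    _ < ε := by
      rw [div_mul_eq_mul_div, div_lt_iff₀ (by positivity)]
      nlinarith

end FourierPositivity

/-! ### Autocorrelations and even powers of the Fourier transform -/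

section Autocorrelation

open Filter Topology Convolution ContinuousLinearMap ComplexConjugate

variable {V : Type*} [NormedAddCommGroup V] [InnerProductSpace ℝ V] [MeasurableSpace V]
  [BorelSpace V] [FiniteDimensional ℝ V]

/-- The autocorrelation `z ↦ ∫ f(s) conj (f(s - z)) ds`. -/
noncomputable def autocorr (f : V → ℂ) : V → ℂ :=
  f ⋆[mul ℂ ℂ] fun x => conj (f (-x))

/-- The `(n+1)`-fold convolution power of the autocorrelation. -/
noncomputable def autocorrPow (f : V → ℂ) : ℕ → V → ℂ
  | 0 => autocorr f
  | n + 1 => autocorrPow f n ⋆[mul ℂ ℂ] autocorr f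

theorem autocorr_apply (f : V → ℂ) (z : V) : autocorr f z = ∫ s, f s * conj (f (s - z)) := by
  simp [autocorr, convolution_mul]

theorem autocorr_neg (f : V → ℂ) (z : V) : autocorr f (-z) = ∫ s, f s * conj (f (s + z)) := by
  simp [autocorr_apply]

theorem integrable_conj_neg {f : V → ℂ} (hf : Integrable f) :
    Integrable fun x => conj (f (-x)) :=
  (Complex.conjCLE : ℂ →L[ℝ] ℂ).integrable_comp hf.comp_neg

theorem integrable_autocorr {f : V → ℂ} (hf : Integrable f) : Integrable (autocorr f) :=
  hf.integrable_convolution _ (integrable_conj_neg hf)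

theorem continuous_autocorr {f : V → ℂ} (hf : Integrable f) {M : ℝ} (hM : ∀ x, ‖f x‖ ≤ M) :
    Continuous (autocorr f) :=
  continuous_convolution_of_integrable_of_bounded hf (integrable_conj_neg hf).aestronglyMeasurable
    (M := M) fun x => by simpa using hM (-x)

theorem fourier_conj_neg (f : V → ℂ) (ξ : V) :
    𝓕 (fun x => conj (f (-x))) ξ = conj (𝓕 f ξ) := by
  rw [Real.fourier_eq, Real.fourier_eq, ← integral_conj, ← integral_neg_eq_self]
  congr with x
  simp only [inner_neg_left, neg_neg, Circle.smul_def, smul_eq_mul, map_mul]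
  congr 1
  rw [← Circle.coe_inv_eq_conj, ← AddChar.map_neg_eq_inv, neg_neg]

theorem fourier_autocorr {f : V → ℂ} (hf : Integrable f) (ξ : V) :
    𝓕 (autocorr f) ξ = ((‖𝓕 f ξ‖ ^ 2 : ℝ) : ℂ) := by
  rw [autocorr, Real.fourier_mul_convolution_eq hf (integrable_conj_neg hf), fourier_conj_neg,
    Complex.mul_conj']
  push_cast
  rfl

theorem norm_autocorr_le {f : V → ℂ} (hf : Integrable f) {M : ℝ} (hM : ∀ x, ‖f x‖ ≤ M) (z : V) :
    ‖autocorr f z‖ ≤ (∫ x, ‖f x‖) * M := by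
  rw [autocorr_apply, ← integral_mul_const]
  refine norm_integral_le_of_norm_le (hf.norm.mul_const M) (Eventually.of_forall fun s => ?_)
  rw [norm_mul]
  gcongr
  simpa using hM _

theorem integrable_autocorrPow {f : V → ℂ} (hf : Integrable f) (n : ℕ) :
    Integrable (autocorrPow f n) := by
  induction n with
  | zero => exact integrable_autocorr hf
  | succ n ih => exact ih.integrable_convolution _ (integrable_autocorr hf)

theorem continuous_autocorrPow {f : V → ℂ} (hf : Integrable f) {M : ℝ} (hM : ∀ x, ‖f x‖ ≤ M)
    (n : ℕ) : Continuous (autocorrPow f n) := by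
  cases n with
  | zero => exact continuous_autocorr hf hM
  | succ n =>
    exact continuous_convolution_of_integrable_of_bounded (integrable_autocorrPow hf n)
      (integrable_autocorr hf).aestronglyMeasurable (norm_autocorr_le hf hM)

theorem fourier_autocorrPow {f : V → ℂ} (hf : Integrable f) (n : ℕ) (ξ : V) :
    𝓕 (autocorrPow f n) ξ = ((‖𝓕 f ξ‖ ^ (2 * (n + 1)) : ℝ) : ℂ) := by
  induction n with
  | zero => exact fourier_autocorr hf ξ
  | succ n ih =>
    rw [autocorrPow, Real.fourier_mul_convolution_eq (integrable_autocorrPow hf n)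
      (integrable_autocorr hf), ih, fourier_autocorr hf]
    push_cast
    ring

/-- The bridge from the frequency side to the physical side: an even `L^q` norm becomes a point
value of an iterated convolution. The index is shifted, `n` corresponding to `q = 2 * (n + 1)`. -/
theorem autocorrPow_zero {f : V → ℂ} (hf : Integrable f) {M : ℝ} (hM : ∀ x, ‖f x‖ ≤ M) (n : ℕ) :
    autocorrPow f n 0 = ((∫ ξ, ‖𝓕 f ξ‖ ^ (2 * (n + 1)) : ℝ) : ℂ) :=
  eq_integral_of_fourier_nonneg (integrable_autocorrPow hf n) (continuous_autocorrPow hf hM n)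
    (fun _ => by positivity) (fourier_autocorrPow hf n)

theorem norm_autocorrPow_le {f : V → ℂ} (hf : Integrable f) {M : ℝ} (hM : ∀ x, ‖f x‖ ≤ M) (n : ℕ)
    (z : V) : ‖autocorrPow f n z‖ ≤ ‖autocorrPow f n 0‖ :=
  norm_le_of_fourier_nonneg (integrable_autocorrPow hf n) (continuous_autocorrPow hf hM n)
    (fun _ => by positivity) (fourier_autocorrPow hf n) z

theorem integrable_norm_fourier_pow {f : V → ℂ} (hf : Integrable f) {M : ℝ}
    (hM : ∀ x, ‖f x‖ ≤ M) (n : ℕ) : Integrable fun ξ => ‖𝓕 f ξ‖ ^ (2 * (n + 1)) := by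
  have := integrable_fourier_of_nonneg (integrable_autocorrPow hf n)
    (continuous_autocorrPow hf hM n) (fun _ => by positivity) (fourier_autocorrPow hf n)
  refine this.norm.congr (Eventually.of_forall fun ξ => ?_)
  simp [fourier_autocorrPow hf n ξ]

/-- **Plancherel** for bounded integrable functions. -/
theorem integral_norm_fourier_sq {f : V → ℂ} (hf : Integrable f) {M : ℝ} (hM : ∀ x, ‖f x‖ ≤ M) :
    ∫ ξ, ‖𝓕 f ξ‖ ^ 2 = ∫ x, ‖f x‖ ^ 2 := by
  have h := autocorrPow_zero hf hM 0
  have h2 : autocorrPow f 0 0 = ((∫ x, ‖f x‖ ^ 2 : ℝ) : ℂ) := by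
    rw [autocorrPow, autocorr_apply, ← integral_complex_ofReal]
    congr with x
    simp [Complex.mul_conj']
  rw [h] at h2
  exact_mod_cast h2

theorem norm_convolution_of_nonneg {A C : V → ℂ} (hA : ∀ x, A x = (‖A x‖ : ℂ))
    (hC : ∀ x, C x = (‖C x‖ : ℂ)) (z : V) :
    ‖(A ⋆[mul ℂ ℂ] C) z‖ = ∫ t, ‖A t‖ * ‖C (z - t)‖ := by
  have : (A ⋆[mul ℂ ℂ] C) z = ((∫ t, ‖A t‖ * ‖C (z - t)‖ : ℝ) : ℂ) := by
    rw [convolution_mul, ← integral_complex_ofReal]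
    congr with t
    rw [hA t, hC (z - t)]
    simp
  rw [this, Complex.norm_real, Real.norm_of_nonneg (integral_nonneg fun t => by positivity)]

theorem convolution_of_nonneg {A C : V → ℂ} (hA : ∀ x, A x = (‖A x‖ : ℂ))
    (hC : ∀ x, C x = (‖C x‖ : ℂ)) (z : V) :
    (A ⋆[mul ℂ ℂ] C) z = (‖(A ⋆[mul ℂ ℂ] C) z‖ : ℂ) := by
  rw [norm_convolution_of_nonneg hA hC, ← integral_complex_ofReal, convolution_mul]
  congr with t
  rw [hA t, hC (z - t)]
  simp

theorem autocorr_ofReal {e : V → ℝ} (he : ∀ x, 0 ≤ e x) (z : V) :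
    autocorr (fun x => (e x : ℂ)) z = (‖autocorr (fun x => (e x : ℂ)) z‖ : ℂ) :=
  convolution_of_nonneg (fun x => by simp [abs_of_nonneg (he x)])
    (fun x => by simp [abs_of_nonneg (he (-x))]) z

theorem autocorrPow_ofReal {e : V → ℝ} (he : ∀ x, 0 ≤ e x) (n : ℕ) (z : V) :
    autocorrPow (fun x => (e x : ℂ)) n z = (‖autocorrPow (fun x => (e x : ℂ)) n z‖ : ℂ) := by
  induction n generalizing z with
  | zero => exact autocorr_ofReal he z
  | succ n ih => exact convolution_of_nonneg ih (autocorr_ofReal he) z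

theorem norm_autocorr_ofReal {e : V → ℝ} (he : ∀ x, 0 ≤ e x) (z : V) :
    ‖autocorr (fun x => (e x : ℂ)) z‖ = ∫ s, e s * e (s - z) := by
  have h := norm_convolution_of_nonneg (A := fun x => (e x : ℂ))
    (C := fun x => conj ((e (-x) : ℝ) : ℂ)) (fun x => by simp [abs_of_nonneg (he x)])
    (fun x => by simp [abs_of_nonneg (he (-x))]) z
  rw [autocorr, h]
  simp [abs_of_nonneg (he _)]

theorem norm_autocorr_le_of_le {f : V → ℂ} {e : V → ℝ} (he : Integrable e) {M : ℝ}
    (hM : ∀ x, e x ≤ M) (hfe : ∀ x, ‖f x‖ ≤ e x) (z : V) :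
    ‖autocorr f z‖ ≤ ‖autocorr (fun x => (e x : ℂ)) z‖ := by
  have h0 : ∀ x, 0 ≤ e x := fun x => (norm_nonneg _).trans (hfe x)
  rw [norm_autocorr_ofReal h0, autocorr_apply]
  refine norm_integral_le_of_norm_le ?_ (Eventually.of_forall fun s => ?_)
  · refine he.mul_bdd (c := M) (he.comp_sub_right z).aestronglyMeasurable
      (Eventually.of_forall fun s => ?_)
    rw [Real.norm_of_nonneg (h0 _)]
    exact hM _
  · rw [norm_mul, RCLike.norm_conj]
    exact mul_le_mul (hfe _) (hfe _) (norm_nonneg _) (h0 _)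

/-- The triangle inequality in each convolution, by induction; this makes the indicator function
extremal among functions bounded by it. -/
theorem norm_autocorrPow_le_of_le {f : V → ℂ} {e : V → ℝ} (he : Integrable e) {M : ℝ}
    (hM : ∀ x, e x ≤ M) (hfe : ∀ x, ‖f x‖ ≤ e x) (n : ℕ) (z : V) :
    ‖autocorrPow f n z‖ ≤ ‖autocorrPow (fun x => (e x : ℂ)) n z‖ := by
  have h0 : ∀ x, 0 ≤ e x := fun x => (norm_nonneg _).trans (hfe x)
  have hM' : ∀ x, ‖(e x : ℂ)‖ ≤ M := fun x => by
    rw [Complex.norm_real, Real.norm_of_nonneg (h0 _)]; exact hM x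
  have he' : Integrable fun x => (e x : ℂ) := he.ofReal
  induction n generalizing z with
  | zero => exact norm_autocorr_le_of_le he hM hfe z
  | succ n ih =>
    rw [autocorrPow, autocorrPow, norm_convolution_of_nonneg (autocorrPow_ofReal h0 n)
      (autocorr_ofReal h0), convolution_mul]
    refine norm_integral_le_of_norm_le ?_ (Eventually.of_forall fun t => ?_)
    · refine (integrable_autocorrPow he' n).norm.mul_bdd (c := (∫ x, ‖(e x : ℂ)‖) * M)
        ((integrable_autocorr he').comp_sub_left z).norm.aestronglyMeasurable
        (Eventually.of_forall fun s => ?_)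
      rw [norm_norm]
      exact norm_autocorr_le he' hM' _
    · rw [norm_mul]
      exact mul_le_mul (ih t) (norm_autocorr_le_of_le he hM hfe _) (norm_nonneg _) (norm_nonneg _)

end Autocorrelation

/-! ### Uniform lower bounds for convolution powers of the ball -/

section BallWeights

set_option linter.unusedSectionVars false

open Filter Topology Convolution ContinuousLinearMap ComplexConjugate Metric

variable {V : Type*} [NormedAddCommGroup V] [InnerProductSpace ℝ V] [MeasurableSpace V]
  [BorelSpace V] [FiniteDimensional ℝ V]

variable (V) in
/-- The indicator function of the centred ball of radius `r`, with complex values. -/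
noncomputable def ballInd (r : ℝ) : V → ℂ := fun x => (((ball (0 : V) r).indicator 1 x : ℝ) : ℂ)

theorem indicator_one_nonneg (r : ℝ) (x : V) : 0 ≤ (ball (0 : V) r).indicator (1 : V → ℝ) x :=
  Set.indicator_nonneg (fun _ _ => zero_le_one) _

theorem indicator_one_le_one (r : ℝ) (x : V) : (ball (0 : V) r).indicator (1 : V → ℝ) x ≤ 1 :=
  Set.indicator_le_self' (fun _ _ => zero_le_one) _

theorem integrable_indicator_one (r : ℝ) : Integrable ((ball (0 : V) r).indicator (1 : V → ℝ)) :=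
  (integrable_indicator_iff measurableSet_ball).2
    (integrableOn_const (C := (1 : ℝ)) measure_ball_lt_top.ne)

theorem integrable_ballInd (r : ℝ) : Integrable (ballInd V r) :=
  (integrable_indicator_one r).ofReal

theorem norm_ballInd_le (r : ℝ) (x : V) : ‖ballInd V r x‖ ≤ 1 := by
  rw [ballInd, Complex.norm_real, Real.norm_of_nonneg (indicator_one_nonneg r x)]
  exact indicator_one_le_one r x

theorem norm_autocorr_ballInd (r : ℝ) (z : V) :
    ‖autocorr (ballInd V r) z‖ = volume.real (ball (0 : V) r ∩ ball z r) := by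
  unfold ballInd
  rw [norm_autocorr_ofReal (indicator_one_nonneg r),
    ← integral_indicator_one (measurableSet_ball.inter measurableSet_ball)]
  congr with s
  rw [Set.inter_indicator_one, Pi.mul_apply]
  congr 1
  have h : s - z ∈ ball (0 : V) r ↔ s ∈ ball z r := by simp [dist_eq_norm]
  by_cases hs : s ∈ ball z r
  · rw [Set.indicator_of_mem hs, Set.indicator_of_mem (h.2 hs)]; rfl
  · rw [Set.indicator_of_notMem hs, Set.indicator_of_notMem (mt h.1 hs)]

theorem norm_autocorr_ballInd_le (r : ℝ) (z : V) :
    ‖autocorr (ballInd V r) z‖ ≤ volume.real (ball (0 : V) r) := by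
  rw [norm_autocorr_ballInd]
  exact measureReal_mono Set.inter_subset_left measure_ball_lt_top.ne

theorem autocorr_ballInd_eq_zero {r : ℝ} {z : V} (hz : 2 * r ≤ ‖z‖) :
    autocorr (ballInd V r) z = 0 := by
  rw [← norm_eq_zero, norm_autocorr_ballInd]
  have : ball (0 : V) r ∩ ball z r = ∅ := by
    refine Set.disjoint_iff_inter_eq_empty.1 (ball_disjoint_ball ?_)
    rw [dist_zero_left]
    linarith
  simp [this]

/-- The ball of radius `1/4` about the midpoint `z / 2` lies in both unit balls, as `3/4 + 1/4 = 1`.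
-/
theorem le_norm_autocorr_ballInd {z : V} (hz : ‖z‖ ≤ 3 / 2) :
    volume.real (ball (0 : V) (1 / 4)) ≤ ‖autocorr (ballInd V 1) z‖ := by
  have h : volume.real (ball (0 : V) (1 / 4)) = volume.real (ball ((1 / 2 : ℝ) • z) (1 / 4)) := by
    simp only [Measure.real, Measure.addHaar_ball_center volume ((1 / 2 : ℝ) • z)]
  have hn : ‖(1 / 2 : ℝ) • z‖ ≤ 3 / 4 := by
    rw [norm_smul]; norm_num; linarith
  rw [norm_autocorr_ballInd, h]
  refine measureReal_mono (Set.subset_inter (ball_subset_ball' ?_) (ball_subset_ball' ?_))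
    (measure_ball_lt_top.trans_le' (measure_mono Set.inter_subset_left)).ne
  · rw [dist_zero_right]; linarith
  · rw [dist_eq_norm, show (1 / 2 : ℝ) • z - z = -((1 / 2 : ℝ) • z) by module, norm_neg]
    linarith

/-- The left side vanishes unless `‖t‖ < 1/2`, and then `‖z - t‖ ≤ 3/2`. A fixed bump thus fits
below every translate of the unit autocorrelation by at most `1`. -/
theorem norm_autocorr_quarter_le {z t : V} (hz : ‖z‖ ≤ 1) :
    ‖autocorr (ballInd V (1 / 4)) t‖ ≤ ‖autocorr (ballInd V 1) (z - t)‖ := by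
  by_cases ht : 2 * (1 / 4) ≤ ‖t‖
  · rw [autocorr_ballInd_eq_zero ht]; simp
  · refine (norm_autocorr_ballInd_le _ _).trans (le_norm_autocorr_ballInd ?_)
    linarith [norm_sub_le z t]

/-- The autocorrelation is nonnegative, so its integral is its Fourier transform at `0`, namely the
square of that of the indicator. -/
theorem integral_norm_autocorr_ballInd (r : ℝ) :
    ∫ z : V, ‖autocorr (ballInd V r) z‖ = volume.real (ball (0 : V) r) ^ 2 := by
  have h := fourier_autocorr (integrable_ballInd (V := V) r) 0
  rw [Real.fourier_eq, Real.fourier_eq] at h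
  simp only [inner_zero_right, neg_zero, AddChar.map_zero_eq_one, one_smul] at h
  have h1 : ∫ v : V, ballInd V r v = ((volume.real (ball (0 : V) r) : ℝ) : ℂ) := by
    unfold ballInd
    rw [integral_complex_ofReal, integral_indicator_one measurableSet_ball]
  have h2 : ∫ v : V, autocorr (ballInd V r) v = ((∫ z : V, ‖autocorr (ballInd V r) z‖ : ℝ) : ℂ) := by
    rw [← integral_complex_ofReal]
    congr with z
    exact autocorr_ofReal (indicator_one_nonneg r) z
  rw [h1, h2, Complex.norm_real, Real.norm_of_nonneg measureReal_nonneg] at h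
  exact_mod_cast h

variable (V) in
/-- The constant in the lower bound for the convolution powers of the ball near the origin. -/
theorem exists_le_norm_autocorrPow_ballInd :
    ∃ c : ℝ, 0 < c ∧ ∀ (n : ℕ) (z : V), ‖z‖ ≤ 1 →
      c * ‖autocorrPow (ballInd V 1) n 0‖ ≤ ‖autocorrPow (ballInd V 1) n z‖ := by
  have hpos : ∀ r : ℝ, 0 < r → 0 < volume.real (ball (0 : V) r) := fun r hr =>
    ENNReal.toReal_pos (measure_ball_pos volume 0 hr).ne' measure_ball_lt_top.ne
  set b := volume.real (ball (0 : V) 1) with hb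
  set b3 := volume.real (ball (0 : V) 3) with hb3
  set q := volume.real (ball (0 : V) (1 / 4)) with hq
  have hb0 : 0 < b := hpos 1 one_pos
  have hb30 : 0 < b3 := hpos 3 (by norm_num)
  have hq0 : 0 < q := hpos _ (by norm_num)
  -- The first entry serves `n = 0`, the second all later powers. Neither depends on `n`.
  refine ⟨min (q / b) (q ^ 2 / (b3 * b)), by positivity, fun n z hz => ?_⟩
  cases n with
  | zero =>
    calc _ ≤ q / b * b := by
            gcongr
            · exact min_le_left _ _
            · exact norm_autocorr_ballInd_le _ _
      _ = q := by field_simp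
      _ ≤ _ := le_norm_autocorr_ballInd (by linarith)
  | succ n =>
    set W := autocorrPow (ballInd V 1) n with hW
    set ψ := autocorr (ballInd V (1 / 4)) with hψ
    set a := autocorr (ballInd V 1) with ha
    have hWp : ∀ x, W x = (‖W x‖ : ℂ) := autocorrPow_ofReal (indicator_one_nonneg 1) n
    have hψp : ∀ x, ψ x = (‖ψ x‖ : ℂ) := autocorr_ofReal (indicator_one_nonneg _)
    have hap : ∀ x, a x = (‖a x‖ : ℂ) := autocorr_ofReal (indicator_one_nonneg _)
    have hWi : Integrable W := integrable_autocorrPow (integrable_ballInd 1) n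
    have hψi : Integrable ψ := integrable_autocorr (integrable_ballInd _)
    have hai : Integrable a := integrable_autocorr (integrable_ballInd _)
    have hψc : Continuous ψ := continuous_autocorr (integrable_ballInd _) (norm_ballInd_le _)
    have hac : Continuous a := continuous_autocorr (integrable_ballInd _) (norm_ballInd_le _)
    have iψ : ∀ x, Integrable fun t => ‖W t‖ * ‖ψ (x - t)‖ := fun x =>
      hWi.norm.mul_bdd (c := q) (by fun_prop)
        (Eventually.of_forall fun t => by rw [norm_norm]; exact norm_autocorr_ballInd_le _ _)
    have ia : ∀ x, Integrable fun t => ‖W t‖ * ‖a (x - t)‖ := fun x =>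
      hWi.norm.mul_bdd (c := b) (by fun_prop)
        (Eventually.of_forall fun t => by rw [norm_norm]; exact norm_autocorr_ballInd_le _ _)
    -- `W ⋆ ψ` has Fourier transform `|1̂_1|^{2(n+1)} |1̂_{1/4}|² ≥ 0`, so it is largest at the
    -- origin.
    have hQ : ∀ x, ∫ t, ‖W t‖ * ‖ψ (x - t)‖ ≤ ∫ t, ‖W t‖ * ‖ψ (0 - t)‖ := by
      intro x
      rw [← norm_convolution_of_nonneg hWp hψp, ← norm_convolution_of_nonneg hWp hψp]
      refine norm_le_of_fourier_nonneg (G := fun ξ => ‖𝓕 (ballInd V 1) ξ‖ ^ (2 * (n + 1)) *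
        ‖𝓕 (ballInd V (1 / 4)) ξ‖ ^ 2) (hWi.integrable_convolution _ hψi)
        (continuous_convolution_of_integrable_of_bounded hWi hψi.aestronglyMeasurable
          (norm_autocorr_ballInd_le _)) (fun ξ => by positivity) (fun ξ => ?_) x
      rw [Real.fourier_mul_convolution_eq hWi hψi, fourier_autocorrPow (integrable_ballInd _),
        fourier_autocorr (integrable_ballInd _)]
      push_cast
      rfl
    -- The last factor `a` is at most `b` and vanishes outside radius `2`.
    have hup : ‖autocorrPow (ballInd V 1) (n + 1) 0‖ ≤ b * ∫ t in ball (0 : V) 2, ‖W t‖ := by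
      rw [autocorrPow, norm_convolution_of_nonneg hWp hap,
        ← setIntegral_eq_integral_of_forall_compl_eq_zero (s := ball (0 : V) 2), ← integral_const_mul]
      · refine setIntegral_mono_on (ia 0).integrableOn (hWi.norm.const_mul b).integrableOn
          measurableSet_ball fun t _ => ?_
        rw [mul_comm]
        gcongr
        exact norm_autocorr_ballInd_le _ _
      · intro t ht
        rw [ha, autocorr_ballInd_eq_zero, norm_zero, mul_zero]
        rw [zero_sub, norm_neg]
        simpa using ht
    have hlow : ∫ t, ‖W t‖ * ‖ψ (0 - t)‖ ≤ ‖autocorrPow (ballInd V 1) (n + 1) z‖ := by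
      rw [autocorrPow, norm_convolution_of_nonneg hWp hap]
      refine integral_mono (iψ 0) (ia z) fun t => ?_
      have h2 := norm_autocorr_quarter_le (t := t) hz
      have h3 : ‖ψ (0 - t)‖ = ‖ψ t‖ := by
        rw [hψ, norm_autocorr_ballInd, norm_autocorr_ballInd]
        have : ball (0 : V) (1 / 4) ∩ ball (0 - t) (1 / 4) =
            (fun x => -x) ⁻¹' (ball (0 : V) (1 / 4) ∩ ball t (1 / 4)) := by
          ext x
          simp only [Set.mem_inter_iff, mem_ball, Set.mem_preimage, dist_eq_norm, sub_zero, norm_neg,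
            zero_sub, sub_neg_eq_add]
          rw [← norm_neg (x + t), neg_add, sub_eq_add_neg]
        rw [this, Measure.real, Measure.real]
        congr 1
        exact (Measure.measurePreserving_neg (volume : Measure V)).measure_preimage
          (measurableSet_ball.inter measurableSet_ball).nullMeasurableSet
      rw [h3]
      gcongr
    -- The maximum of `W ⋆ ψ` exceeds its average over radius `3`. For `‖t‖ < 2` that ball contains
    -- the whole support of `ψ (· - t)`, which has radius `1/2`, so the inner integral is the full
    -- mass `q ^ 2`.
    have hmid : q ^ 2 * ∫ t in ball (0 : V) 2, ‖W t‖ ≤ b3 * ∫ t, ‖W t‖ * ‖ψ (0 - t)‖ := by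
      have hprod : Integrable (Function.uncurry fun x t => ‖W t‖ * ‖ψ (x - t)‖)
          ((volume.restrict (ball (0 : V) 3)).prod volume) := by
        have := hWi.norm.convolution_integrand (mul ℝ ℝ) hψi.norm
        refine Integrable.mono_measure this ?_
        exact Measure.prod_mono Measure.restrict_le_self le_rfl
      calc q ^ 2 * ∫ t in ball (0 : V) 2, ‖W t‖
          = ∫ t in ball (0 : V) 2, ‖W t‖ * ∫ x in ball (0 : V) 3, ‖ψ (x - t)‖ := by
            rw [← integral_const_mul]
            refine setIntegral_congr_fun measurableSet_ball fun t ht => ?_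
            rw [setIntegral_eq_integral_of_forall_compl_eq_zero,
              integral_sub_right_eq_self (fun x => ‖ψ x‖), integral_norm_autocorr_ballInd, mul_comm]
            intro x hx
            rw [hψ, autocorr_ballInd_eq_zero, norm_zero]
            simp only [mem_ball, dist_zero_right, not_lt] at hx ht
            linarith [norm_sub_norm_le x t]
        _ ≤ ∫ t, ‖W t‖ * ∫ x in ball (0 : V) 3, ‖ψ (x - t)‖ := by
            have := hprod.integral_prod_right
            simp only [Function.uncurry, integral_const_mul] at this
            exact setIntegral_le_integral this (Eventually.of_forall fun t =>
              mul_nonneg (norm_nonneg _) (integral_nonneg fun _ => norm_nonneg _))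
        _ = ∫ x in ball (0 : V) 3, ∫ t, ‖W t‖ * ‖ψ (x - t)‖ := by
            rw [integral_integral_swap hprod]
            simp only [integral_const_mul]
        _ ≤ ∫ x in ball (0 : V) 3, ∫ t, ‖W t‖ * ‖ψ (0 - t)‖ := by
            refine integral_mono hprod.integral_prod_left ?_ hQ
            exact integrableOn_const measure_ball_lt_top.ne
        _ = _ := by simp [hb3]
    calc _ ≤ q ^ 2 / (b3 * b) * (b * ∫ t in ball (0 : V) 2, ‖W t‖) := by
            gcongr
            exact min_le_right _ _
      _ = (q ^ 2 * ∫ t in ball (0 : V) 2, ‖W t‖) / b3 := by field_simp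
      _ ≤ (b3 * ∫ t, ‖W t‖ * ‖ψ (0 - t)‖) / b3 := by gcongr
      _ = ∫ t, ‖W t‖ * ‖ψ (0 - t)‖ := by field_simp
      _ ≤ _ := hlow

end BallWeights

/-! ### Near-extremality forces near-multiplicativity -/

section NearMultiplicative

set_option linter.unusedSectionVars false

open Filter Topology Convolution ContinuousLinearMap ComplexConjugate Metric

variable {V : Type*} [NormedAddCommGroup V] [InnerProductSpace ℝ V] [MeasurableSpace V]
  [BorelSpace V] [FiniteDimensional ℝ V]

/-- The `L¹` size, over the points of the unit ball that stay in it when translated by `t`, of the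
failure of `h (s + t) = φ t * h s`. -/
noncomputable def transDefect (h φ : V → ℂ) (t : V) : ℝ≥0∞ :=
  ∫⁻ s in ball (0 : V) 1 ∩ (fun s => s + t) ⁻¹' ball (0 : V) 1, ‖h (s + t) - φ t * h s‖ₑ

theorem integral_norm_fourier_ballInd_pos (n : ℕ) :
    0 < ∫ ξ : V, ‖𝓕 (ballInd V 1) ξ‖ ^ (2 * (n + 1)) := by
  have hc : Continuous (𝓕 (ballInd V 1)) := VectorFourier.fourierIntegral_continuous
      Real.continuous_fourierChar continuous_inner (integrable_ballInd 1)
  rw [integral_pos_iff_support_of_nonneg (fun ξ => by positivity)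
    (integrable_norm_fourier_pow (integrable_ballInd 1) (norm_ballInd_le 1) n)]
  have ho : IsOpen (Function.support fun ξ : V => ‖𝓕 (ballInd V 1) ξ‖ ^ (2 * (n + 1))) :=
    Continuous.isOpen_support (by fun_prop)
  refine ho.measure_pos volume ⟨0, ?_⟩
  have h1 : 𝓕 (ballInd V 1) 0 = ((volume.real (ball (0 : V) 1) : ℝ) : ℂ) := by
    rw [Real.fourier_eq]
    simp only [inner_zero_right, neg_zero, AddChar.map_zero_eq_one, one_smul]
    unfold ballInd
    rw [integral_complex_ofReal, integral_indicator_one measurableSet_ball]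
  have h2 : 0 < volume.real (ball (0 : V) 1) :=
    ENNReal.toReal_pos (measure_ball_pos volume 0 one_pos).ne' measure_ball_lt_top.ne
  simp only [Function.mem_support, h1]
  exact pow_ne_zero _ (norm_ne_zero_iff.2 (Complex.ofReal_ne_zero.2 h2.ne'))

theorem norm_indicator_le {h : V → ℂ} (h1 : ∀ x, ‖h x‖ = 1) (r : ℝ) (x : V) :
    ‖(ball (0 : V) r).indicator h x‖ ≤ (ball (0 : V) r).indicator (1 : V → ℝ) x := by
  by_cases hx : x ∈ ball (0 : V) r
  · simp [Set.indicator_of_mem hx, h1]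
  · simp [Set.indicator_of_notMem hx]

theorem integrable_ball_indicator {h : V → ℂ} (hm : Measurable h) (h1 : ∀ x, ‖h x‖ = 1) (r : ℝ) :
    Integrable ((ball (0 : V) r).indicator h) :=
  (integrable_indicator_one r).mono' (hm.indicator measurableSet_ball).aestronglyMeasurable
    (Eventually.of_forall (norm_indicator_le h1 r))

/-- Expand the square and use `‖u‖² ≤ 1`. It turns a deficit in a correlation into an `L²` distance.
-/
theorem norm_sub_sq_le_of_norm_le_one {x y u : ℂ} (hx : ‖x‖ = 1) (hy : ‖y‖ = 1) (hu : ‖u‖ ≤ 1) :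
    ‖x - u * y‖ ^ 2 ≤ 2 * (1 - (u * (y * conj x)).re) := by
  rw [← Complex.normSq_eq_norm_sq, Complex.normSq_sub, Complex.normSq_eq_norm_sq,
    Complex.normSq_eq_norm_sq, norm_mul, hx, hy]
  have : (x * conj (u * y)).re = (u * (y * conj x)).re := by
    simp only [Complex.mul_re, Complex.mul_im, Complex.conj_re, Complex.conj_im, map_mul]
    ring
  rw [this]
  nlinarith [norm_nonneg u]

variable (V) in
/-- If the `L^q` norm of the Fourier transform of a unimodular function on the unit ball is nearly
that of the indicator function, the function is nearly multiplicative under translations. -/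
theorem exists_lintegral_transDefect_le :
    ∃ C : ℝ, 0 < C ∧ ∀ (n : ℕ) (η : ℝ) (h : V → ℂ), 0 < η → Measurable h → (∀ x, ‖h x‖ = 1) →
      (1 - η) * ∫ ξ, ‖𝓕 (ballInd V 1) ξ‖ ^ (2 * (n + 2)) ≤
        ∫ ξ, ‖𝓕 ((ball (0 : V) 1).indicator h) ξ‖ ^ (2 * (n + 2)) →
      ∃ φ : V → ℂ, Measurable φ ∧ (∀ t, ‖φ t‖ ≤ 1) ∧
        ∫⁻ t in ball (0 : V) 1, transDefect h φ t ≤ ENNReal.ofReal (C * √η) := by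
  obtain ⟨c, hc, hcw⟩ := exists_le_norm_autocorrPow_ballInd V
  set b := volume.real (ball (0 : V) 1) with hb
  have hb0 : 0 < b :=
    ENNReal.toReal_pos (measure_ball_pos volume 0 one_pos).ne' measure_ball_lt_top.ne
  refine ⟨b ^ 2 * (1 / 2 + 1 / c), by positivity, fun n η h hη hm h1 hle => ?_⟩
  set f := (ball (0 : V) 1).indicator h with hf
  have hfi : Integrable f := integrable_ball_indicator hm h1 1
  have hfe : ∀ x, ‖f x‖ ≤ (ball (0 : V) 1).indicator (1 : V → ℝ) x := norm_indicator_le h1 1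
  have hf1 : ∀ x, ‖f x‖ ≤ 1 := fun x => (hfe x).trans (indicator_one_le_one 1 x)
  have hii := integrable_ballInd (V := V) 1
  have hi1 := norm_ballInd_le (V := V) 1
  set W := autocorrPow (ballInd V 1) n with hW
  set P := autocorrPow f n with hP
  have hWi : Integrable W := integrable_autocorrPow hii n
  have hPi : Integrable P := integrable_autocorrPow hfi n
  have hWc : Continuous W := continuous_autocorrPow hii hi1 n
  have hPc : Continuous P := continuous_autocorrPow hfi hf1 n
  have hPW : ∀ t, ‖P t‖ ≤ ‖W t‖ := norm_autocorrPow_le_of_le (integrable_indicator_one 1)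
    (indicator_one_le_one 1) hfe n
  set w0 := ‖W 0‖ with hw0
  have hw0p : 0 < w0 := by
    rw [hw0, hW, autocorrPow_zero hii hi1, Complex.norm_real]
    exact norm_pos_iff.2 (integral_norm_fourier_ballInd_pos n).ne'
  have hWw0 : ∀ t, ‖W t‖ ≤ w0 := norm_autocorrPow_le hii hi1 n
  set X : V → ℂ := fun t => autocorr f (0 - t) with hX
  set Y : V → ℝ := fun t => ‖autocorr (ballInd V 1) (0 - t)‖ with hY
  have hXc : Continuous X := (continuous_autocorr hfi hf1).comp (by fun_prop)
  have hYc : Continuous Y := ((continuous_autocorr hii hi1).comp (by fun_prop)).norm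
  have hXY : ∀ t, ‖X t‖ ≤ Y t := fun t => norm_autocorr_le_of_le (integrable_indicator_one 1)
    (indicator_one_le_one 1) hfe _
  have hYb : ∀ t, Y t ≤ b := fun t => norm_autocorr_ballInd_le _ _
  have hY0 : ∀ t, 0 ≤ Y t := fun t => norm_nonneg _
  have hYi : Integrable Y := ((integrable_autocorr hii).comp_sub_left 0).norm
  have hWYi : Integrable fun t => ‖W t‖ * Y t := hWi.norm.mul_bdd (c := b)
    hYc.aestronglyMeasurable (Eventually.of_forall fun t => by
      rw [Real.norm_of_nonneg (hY0 t)]; exact hYb t)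
  have hPXi : Integrable fun t => P t * X t := hPi.mul_bdd (c := b)
    hXc.aestronglyMeasurable (Eventually.of_forall fun t => (hXY t).trans (hYb t))
  -- The deficit of the convolution integral at `0`, localised in `t`. It is pointwise nonnegative
  -- and its total is at most `η` times the integral for the ball.
  set R : V → ℝ := fun t => ‖W t‖ * Y t - (P t * X t).re with hR
  have hRi : Integrable R := hWYi.sub hPXi.re
  have hR0 : ∀ t, 0 ≤ R t := fun t => by
    have h2 : (P t * X t).re ≤ ‖W t‖ * Y t := by
      refine (Complex.re_le_norm _).trans ?_
      rw [norm_mul]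
      exact mul_le_mul (hPW t) (hXY t) (norm_nonneg _) (norm_nonneg _)
    simp only [hR]; linarith
  have hWY : ∫ t, ‖W t‖ * Y t = ∫ ξ, ‖𝓕 (ballInd V 1) ξ‖ ^ (2 * (n + 2)) := by
    have h2 := autocorrPow_zero hii hi1 (n + 1)
    have h3 := norm_convolution_of_nonneg (autocorrPow_ofReal (indicator_one_nonneg (V := V) 1) n)
      (autocorr_ofReal (indicator_one_nonneg (V := V) 1)) 0
    rw [show (∫ t, ‖W t‖ * Y t) = ‖autocorrPow (ballInd V 1) (n + 1) 0‖ from h3.symm, h2,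
      Complex.norm_real, Real.norm_of_nonneg (integral_nonneg fun _ => by positivity)]
  have hPX : ∫ t, (P t * X t).re = ∫ ξ, ‖𝓕 f ξ‖ ^ (2 * (n + 2)) := by
    have h2 := autocorrPow_zero hfi hf1 (n + 1)
    have h3 : autocorrPow f (n + 1) 0 = ∫ t, P t * X t := rfl
    have h4 := integral_re hPXi
    simp only [RCLike.re_to_complex] at h4
    rw [h4, ← h3, h2, Complex.ofReal_re]
  have hWYle : ∫ t, ‖W t‖ * Y t ≤ w0 * b ^ 2 := by
    calc ∫ t, ‖W t‖ * Y t ≤ ∫ t, w0 * Y t := integral_mono hWYi (hYi.const_mul _) fun t =>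
            mul_le_mul_of_nonneg_right (hWw0 t) (hY0 t)
      _ = w0 * b ^ 2 := by
        rw [integral_const_mul, integral_sub_left_eq_self fun t => ‖autocorr (ballInd V 1) t‖,
          integral_norm_autocorr_ballInd]
  have hRint : ∫ t, R t ≤ η * (w0 * b ^ 2) := by
    have : ∫ t, R t = (∫ t, ‖W t‖ * Y t) - ∫ t, (P t * X t).re := integral_sub hWYi hPXi.re
    rw [this, hPX, hWY]
    rw [hWY] at hWYle
    nlinarith
  -- Where `W` vanishes the quotient is `0`, which keeps the bound by `1`; on the unit ball `W` is
  -- bounded below.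
  refine ⟨fun t => P t / W t, hPc.measurable.div hWc.measurable, fun t => ?_, ?_⟩
  · rw [norm_div]
    exact div_le_one_of_le₀ (hPW t) (norm_nonneg _)
  have hs : 0 < √η := Real.sqrt_pos.2 hη
  have hss : √η * √η = η := Real.mul_self_sqrt hη.le
  have hpt : ∀ t ∈ ball (0 : V) 1, transDefect h (fun t => P t / W t) t ≤
      ENNReal.ofReal (√η * b / 2 + R t / (c * w0 * √η)) := by
    intro t ht
    have hWt : c * w0 ≤ ‖W t‖ := hcw n t (by simpa using (mem_ball_zero_iff.1 ht).le)
    have hWt0 : 0 < ‖W t‖ := (mul_pos hc hw0p).trans_le hWt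
    set u := P t / W t with hu
    have hu1 : ‖u‖ ≤ 1 := by
      rw [hu, norm_div]; exact div_le_one_of_le₀ (hPW t) (norm_nonneg _)
    set S := ball (0 : V) 1 ∩ (fun s => s + t) ⁻¹' ball (0 : V) 1 with hS
    have hSm : MeasurableSet S :=
      measurableSet_ball.inter (measurableSet_ball.preimage (measurable_add_const t))
    have hSfin : volume S ≠ ⊤ := (measure_ball_lt_top.trans_le'
      (measure_mono Set.inter_subset_left)).ne
    have hYS : Y t = volume.real S := by
      simp only [hY]
      rw [norm_autocorr_ballInd]
      congr 1
      ext x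
      simp [hS, dist_eq_norm]
    have hXS : X t = ∫ s in S, h s * conj (h (s + t)) := by
      simp only [hX, autocorr_apply]
      rw [← integral_indicator hSm]
      congr with s
      simp only [hf, zero_sub, sub_neg_eq_add]
      by_cases hs1 : s ∈ ball (0 : V) 1 <;> by_cases hs2 : s + t ∈ ball (0 : V) 1
      · rw [Set.indicator_of_mem hs1, Set.indicator_of_mem hs2, Set.indicator_of_mem (show s ∈ S from ⟨hs1, hs2⟩)]
      · rw [Set.indicator_of_notMem hs2, Set.indicator_of_notMem (fun h : s ∈ S => hs2 h.2)]; simp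
      · rw [Set.indicator_of_notMem hs1, Set.indicator_of_notMem (fun h : s ∈ S => hs1 h.1)]; simp
      · rw [Set.indicator_of_notMem hs1, Set.indicator_of_notMem (fun h : s ∈ S => hs1 h.1)]; simp
    have hgm : Measurable fun s => h s * conj (h (s + t)) := by fun_prop
    have hgi : IntegrableOn (fun s => h s * conj (h (s + t))) S :=
      Measure.integrableOn_of_bounded (M := 1) hSfin hgm.aestronglyMeasurable
        (Eventually.of_forall fun s => by simp [h1])
    have hdm : Measurable fun s => h (s + t) - u * h s := by fun_prop
    have hdi : IntegrableOn (fun s => h (s + t) - u * h s) S :=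
      Measure.integrableOn_of_bounded (M := 2) hSfin hdm.aestronglyMeasurable
        (Eventually.of_forall fun s => by
          refine (norm_sub_le _ _).trans ?_
          rw [norm_mul, h1, h1]; linarith)
    have hui : IntegrableOn (fun s => (u * (h s * conj (h (s + t)))).re) S := (hgi.const_mul u).re
    have h1i : IntegrableOn (fun _ : V => (1 : ℝ)) S := integrableOn_const hSfin
    have hsi : IntegrableOn (fun s => 1 - (u * (h s * conj (h (s + t)))).re) S := h1i.sub hui
    have e1 : transDefect h (fun t => P t / W t) t =
        ENNReal.ofReal (∫ s in S, ‖h (s + t) - u * h s‖) := by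
      rw [ofReal_integral_norm_eq_lintegral_enorm hdi]
      rfl
    rw [e1]
    refine ENNReal.ofReal_le_ofReal ?_
    -- The inequality `x ≤ √η / 2 + x² / (2√η)` passes from the quadratic deficit to an `L¹` bound;
    -- the weight `√η` balances the two terms after integration in `t`.
    calc ∫ s in S, ‖h (s + t) - u * h s‖
        ≤ ∫ s in S, (√η / 2 * 1 + (√η)⁻¹ * (1 - (u * (h s * conj (h (s + t)))).re)) := by
          refine integral_mono hdi.norm
            ((h1i.const_mul _).add (hsi.const_mul _)) fun s => ?_
          have h2 := norm_sub_sq_le_of_norm_le_one (h1 (s + t)) (h1 s) hu1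
          set x := ‖h (s + t) - u * h s‖
          have h3 : x ≤ √η / 2 * 1 + (√η)⁻¹ * (x ^ 2 / 2) := by
            rw [← sub_nonneg]
            have : √η / 2 * 1 + (√η)⁻¹ * (x ^ 2 / 2) - x = (√η)⁻¹ * ((x - √η) ^ 2 / 2) := by
              field_simp; ring
            rw [this]; positivity
          refine h3.trans ?_
          gcongr
          linarith
      _ = √η * Y t / 2 + (√η)⁻¹ * (Y t - (u * X t).re) := by
          rw [integral_add (h1i.const_mul (√η / 2)) (hsi.const_mul _), integral_const_mul,
            integral_const_mul, integral_sub h1i hui]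
          have h4 := integral_re (hgi.const_mul u)
          simp only [RCLike.re_to_complex] at h4
          rw [h4, integral_const_mul, ← hXS, hYS]
          simp
          ring
      _ ≤ √η * b / 2 + R t / (c * w0 * √η) := by
          have h5 : Y t - (u * X t).re = R t / ‖W t‖ := by
            have hWr : W t = (‖W t‖ : ℂ) := autocorrPow_ofReal (indicator_one_nonneg 1) n t
            rw [eq_div_iff hWt0.ne']
            have : u * X t = (P t * X t) / (‖W t‖ : ℂ) := by
              rw [hu, ← hWr]; ring
            rw [this, Complex.div_ofReal_re]
            simp only [hR]
            field_simp
          rw [h5]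
          have h6 : R t / ‖W t‖ ≤ R t / (c * w0) := by
            gcongr
            exact hR0 t
          have h7 : R t / (c * w0 * √η) = (√η)⁻¹ * (R t / (c * w0)) := by field_simp
          rw [h7]
          gcongr
          exact hYb t
  have hci : IntegrableOn (fun _ : V => √η * b / 2) (ball (0 : V) 1) :=
    integrableOn_const measure_ball_lt_top.ne
  have hRi' : IntegrableOn (fun t => R t / (c * w0 * √η)) (ball (0 : V) 1) :=
    (hRi.div_const _).integrableOn
  have hsum : IntegrableOn (fun t => √η * b / 2 + R t / (c * w0 * √η)) (ball (0 : V) 1) :=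
    hci.add hRi'
  calc ∫⁻ t in ball (0 : V) 1, transDefect h (fun t => P t / W t) t
      ≤ ∫⁻ t in ball (0 : V) 1, ENNReal.ofReal (√η * b / 2 + R t / (c * w0 * √η)) :=
        setLIntegral_mono' measurableSet_ball hpt
    _ = ENNReal.ofReal (∫ t in ball (0 : V) 1, (√η * b / 2 + R t / (c * w0 * √η))) := by
        rw [ofReal_integral_eq_lintegral_ofReal hsum]
        exact Eventually.of_forall fun t => add_nonneg (by positivity)
          (div_nonneg (hR0 t) (by positivity))
    _ ≤ _ := by
        refine ENNReal.ofReal_le_ofReal ?_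
        rw [integral_add hci hRi', integral_div (c * w0 * √η)]
        have h8 : ∫ t in ball (0 : V) 1, R t ≤ η * (w0 * b ^ 2) :=
          (setIntegral_le_integral hRi (Eventually.of_forall hR0)).trans hRint
        have h9 : (∫ t in ball (0 : V) 1, R t) / (c * w0 * √η) ≤
            η * (w0 * b ^ 2) / (c * w0 * √η) := by gcongr
        -- The peak value `w0` cancels, so the constant does not depend on the exponent.
        have h10 : η * (w0 * b ^ 2) / (c * w0 * √η) = b ^ 2 * (1 / c) * √η := by
          nth_rewrite 1 [← hss]; field_simp
        rw [h10] at h9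
        have h11 : ∫ _ in ball (0 : V) 1, √η * b / 2 = b ^ 2 * (1 / 2) * √η := by
          simp [← hb]; ring
        rw [h11]
        linarith

end NearMultiplicative

/-! ### Small translations act almost as unimodular constants -/

section Translations

open Filter Topology Metric

variable {V : Type*} [NormedAddCommGroup V] [InnerProductSpace ℝ V] [MeasurableSpace V]
  [BorelSpace V] [FiniteDimensional ℝ V]

set_option linter.unusedSectionVars false

theorem setLIntegral_sub_left_le {A B : Set V} (hA : MeasurableSet A) (hB : MeasurableSet B)
    (F : V → ℝ≥0∞) {z : V} (h : ∀ s ∈ A, z - s ∈ B) :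
    ∫⁻ s in A, F (z - s) ≤ ∫⁻ t in B, F t := by
  rw [← lintegral_indicator hA, ← lintegral_indicator hB,
    ← lintegral_sub_left_eq_self (μ := volume) (B.indicator F) z]
  refine lintegral_mono fun s => ?_
  by_cases hs : s ∈ A
  · rw [Set.indicator_of_mem hs, Set.indicator_of_mem (h s hs)]
  · rw [Set.indicator_of_notMem hs]; exact zero_le

theorem setLIntegral_add_right_le {A B : Set V} (hA : MeasurableSet A) (hB : MeasurableSet B)
    (F : V → ℝ≥0∞) {z : V} (h : ∀ s ∈ A, s + z ∈ B) :
    ∫⁻ s in A, F (s + z) ≤ ∫⁻ t in B, F t := by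
  rw [← lintegral_indicator hA, ← lintegral_indicator hB,
    ← lintegral_add_right_eq_self (μ := volume) (B.indicator F) z]
  refine lintegral_mono fun s => ?_
  by_cases hs : s ∈ A
  · rw [Set.indicator_of_mem hs, Set.indicator_of_mem (h s hs)]
  · rw [Set.indicator_of_notMem hs]; exact zero_le

theorem measurable_transDefect {h φ : V → ℂ} (hm : Measurable h) (hφ : Measurable φ) :
    Measurable (transDefect h φ) := by
  have hS : MeasurableSet {p : V × V | p.2 ∈ ball (0 : V) 1 ∧ p.2 + p.1 ∈ ball (0 : V) 1} :=
    (measurableSet_ball.preimage measurable_snd).inter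
      (measurableSet_ball.preimage (measurable_snd.add measurable_fst))
  have hF : Measurable fun p : V × V => ‖h (p.2 + p.1) - φ p.1 * h p.2‖ₑ := by fun_prop
  have := (hF.indicator hS).lintegral_prod_right' (ν := volume)
  convert! this using 2 with t
  rw [transDefect, ← lintegral_indicator
    (measurableSet_ball.inter (measurableSet_ball.preimage (measurable_add_const t)))]
  rfl

theorem measureReal_ball_pos (x : V) {r : ℝ} (hr : 0 < r) : 0 < volume.real (ball x r) :=
  ENNReal.toReal_pos (measure_ball_pos volume x hr).ne' measure_ball_lt_top.ne

theorem ofReal_measureReal_ball (x : V) (r : ℝ) :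
    ENNReal.ofReal (volume.real (ball x r)) = volume (ball x r) :=
  ENNReal.ofReal_toReal measure_ball_lt_top.ne

/-- A constant whose integral over a ball is small is small. -/
theorem norm_mul_measureReal_ball_le {c : ℂ} {x : V} {r τ : ℝ} (hτ : 0 ≤ τ)
    (h : ∫⁻ _ in ball x r, ‖c‖ₑ ≤ ENNReal.ofReal τ) : ‖c‖ * volume.real (ball x r) ≤ τ := by
  rw [setLIntegral_const, ← ofReal_measureReal_ball, ← ofReal_norm,
    ← ENNReal.ofReal_mul (norm_nonneg _)] at h
  exact (ENNReal.ofReal_le_ofReal_iff hτ).1 h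

/-- Radial projection onto the circle. -/
theorem exists_norm_eq_one_norm_sub_le (κ : ℂ) :
    ∃ c : ℂ, ‖c‖ = 1 ∧ ∀ x : ℂ, ‖x‖ = 1 → ‖c - κ‖ ≤ ‖x - κ‖ := by
  by_cases h : κ = 0
  · exact ⟨1, by simp, fun x hx => by simp [h, hx]⟩
  · have hn : ‖κ‖ ≠ 0 := norm_ne_zero_iff.2 h
    refine ⟨κ / ‖κ‖, by simp [hn], fun x hx => ?_⟩
    have e : κ / ‖κ‖ - κ = (κ / ‖κ‖) * ((1 - ‖κ‖ : ℝ) : ℂ) := by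
      push_cast
      have : (‖κ‖ : ℂ) ≠ 0 := by exact_mod_cast hn
      field_simp
    rw [e, norm_mul, Complex.norm_real, norm_div, Complex.norm_real, norm_norm, div_self hn,
      one_mul, ← hx]
    exact abs_norm_sub_norm_le x κ

/-- Every small translation acts on a nearly multiplicative unimodular function almost as a
unimodular constant. -/
theorem exists_unimodular_translation {h φ : V → ℂ} (hm : Measurable h) (h1 : ∀ x, ‖h x‖ = 1)
    (hφ : Measurable φ) (hφ1 : ∀ t, ‖φ t‖ ≤ 1) {ε : ℝ} (hε : 0 ≤ ε)
    (hd : ∫⁻ t in ball (0 : V) 1, transDefect h φ t ≤ ENNReal.ofReal ε) {z : V} (hz : ‖z‖ ≤ 1 / 4) :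
    ∃ c : ℂ, ‖c‖ = 1 ∧ ∫⁻ u in ball (0 : V) (1 / 4), ‖h (u + z) - c * h u‖ₑ ≤
      ENNReal.ofReal (4 * ε / volume.real (ball (0 : V) (1 / 4))) := by
  set v := volume.real (ball (0 : V) (1 / 4)) with hv
  have hv0 : 0 < v := measureReal_ball_pos _ (by norm_num)
  have hDm := measurable_transDefect hm hφ
  -- The defect is controlled only on average over translations. Splitting `z = (z - s) + s` and
  -- averaging over `s` yields a decomposition with both parts good, so every `z` is covered.
  obtain ⟨s, hs, hsle⟩ : ∃ s ∈ ball (0 : V) (1 / 4),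
      transDefect h φ (z - s) + transDefect h φ s ≤ ENNReal.ofReal (2 * ε / v) := by
    obtain ⟨s, hs, hsle⟩ := exists_le_setLAverage (μ := (volume : Measure V))
      (s := ball (0 : V) (1 / 4)) (f := fun s => transDefect h φ (z - s) + transDefect h φ s)
      (measure_ball_pos volume 0 (by norm_num)).ne' measure_ball_lt_top.ne
      ((hDm.comp (measurable_const_sub z)).add hDm).aemeasurable
    refine ⟨s, hs, hsle.trans ?_⟩
    rw [setLAverage_eq, ENNReal.ofReal_div_of_pos hv0, hv, ofReal_measureReal_ball]
    gcongr
    rw [lintegral_add_right _ hDm, two_mul, ENNReal.ofReal_add hε hε]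
    gcongr
    · refine (setLIntegral_sub_left_le measurableSet_ball measurableSet_ball _ fun s hs => ?_).trans
        hd
      rw [mem_ball_zero_iff] at hs ⊢
      linarith [norm_sub_le z s]
    · exact (lintegral_mono_set (ball_subset_ball (by norm_num))).trans hd
  rw [mem_ball_zero_iff] at hs
  set κ := φ (z - s) * φ s with hκ
  have hκle : ∫⁻ u in ball (0 : V) (1 / 4), ‖h (u + z) - κ * h u‖ₑ ≤ ENNReal.ofReal (2 * ε / v) := by
    refine le_trans ?_ hsle
    have hsub : ∀ u ∈ ball (0 : V) (1 / 4), u + z ∈ ball (0 : V) 1 ∧ u + s ∈ ball (0 : V) 1 ∧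
        u ∈ ball (0 : V) 1 := fun u hu => by
      simp only [mem_ball_zero_iff] at hu ⊢
      exact ⟨by linarith [norm_add_le u z], by linarith [norm_add_le u s], by linarith⟩
    calc ∫⁻ u in ball (0 : V) (1 / 4), ‖h (u + z) - κ * h u‖ₑ
        ≤ ∫⁻ u in ball (0 : V) (1 / 4), (‖h ((u + s) + (z - s)) - φ (z - s) * h (u + s)‖ₑ +
            ‖h (u + s) - φ s * h u‖ₑ) := by
          refine lintegral_mono fun u => ?_
          have e : h (u + z) - κ * h u = (h ((u + s) + (z - s)) - φ (z - s) * h (u + s)) +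
              φ (z - s) * (h (u + s) - φ s * h u) := by
            rw [show (u + s) + (z - s) = u + z by abel, hκ]; ring
          rw [e]
          refine (enorm_add_le _ _).trans ?_
          gcongr
          rw [enorm_mul]
          refine mul_le_of_le_one_left zero_le ?_
          rw [← ofReal_norm]
          exact ENNReal.ofReal_le_one.2 (hφ1 _)
      _ = (∫⁻ u in ball (0 : V) (1 / 4), ‖h ((u + s) + (z - s)) - φ (z - s) * h (u + s)‖ₑ) +
          ∫⁻ u in ball (0 : V) (1 / 4), ‖h (u + s) - φ s * h u‖ₑ :=
          lintegral_add_left (by fun_prop) _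
      _ ≤ _ := by
          gcongr
          · refine setLIntegral_add_right_le (F := fun u => ‖h (u + (z - s)) - φ (z - s) * h u‖ₑ)
              measurableSet_ball (measurableSet_ball.inter
                (measurableSet_ball.preimage (measurable_add_const _))) fun u hu => ?_
            refine ⟨(hsub u hu).2.1, ?_⟩
            rw [Set.mem_preimage, show (u + s) + (z - s) = u + z by abel]
            exact (hsub u hu).1
          · exact lintegral_mono_set fun u hu => ⟨(hsub u hu).2.2, (hsub u hu).2.1⟩
  -- For each `u` the unimodular number `h (u + z) / h u` competes with `c`, so replacing `κ` by `c`
  -- at most doubles the error.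
  obtain ⟨c, hc1, hc⟩ := exists_norm_eq_one_norm_sub_le κ
  refine ⟨c, hc1, ?_⟩
  calc ∫⁻ u in ball (0 : V) (1 / 4), ‖h (u + z) - c * h u‖ₑ
      ≤ ∫⁻ u in ball (0 : V) (1 / 4), (‖h (u + z) - κ * h u‖ₑ + ‖h (u + z) - κ * h u‖ₑ) := by
        refine lintegral_mono fun u => ?_
        have e : h (u + z) - c * h u = (h (u + z) - κ * h u) - (c - κ) * h u := by ring
        rw [e]
        refine enorm_sub_le.trans ?_
        gcongr
        rw [← ofReal_norm, ← ofReal_norm]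
        refine ENNReal.ofReal_le_ofReal ?_
        have hu0 : h u ≠ 0 := norm_ne_zero_iff.1 (by rw [h1]; exact one_ne_zero)
        have h2 := hc (h (u + z) / h u) (by rw [norm_div, h1, h1, div_one])
        have h3 : ‖h (u + z) / h u - κ‖ = ‖h (u + z) - κ * h u‖ := by
          rw [div_sub' hu0, norm_div, h1, div_one, mul_comm κ]
        rw [norm_mul, h1, mul_one, ← h3]
        exact h2
    _ = (∫⁻ u in ball (0 : V) (1 / 4), ‖h (u + z) - κ * h u‖ₑ) +
        ∫⁻ u in ball (0 : V) (1 / 4), ‖h (u + z) - κ * h u‖ₑ := lintegral_add_left (by fun_prop) _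
    _ ≤ ENNReal.ofReal (2 * ε / v) + ENNReal.ofReal (2 * ε / v) := by gcongr
    _ = _ := by
        rw [← ENNReal.ofReal_add (by positivity) (by positivity)]
        congr 1; ring

/-- The constants by which small translations act are nearly multiplicative. -/
theorem norm_translation_const_sub_mul_le {h : V → ℂ} (hm : Measurable h) (h1 : ∀ x, ‖h x‖ = 1)
    {c : V → ℂ} {τ : ℝ} (hτ : 0 ≤ τ) (hc1 : ∀ z, ‖z‖ ≤ 1 / 4 → ‖c z‖ = 1)
    (hc : ∀ z, ‖z‖ ≤ 1 / 4 → ∫⁻ u in ball (0 : V) (1 / 4), ‖h (u + z) - c z * h u‖ₑ ≤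
      ENNReal.ofReal τ) {z z' : V} (hz : ‖z‖ ≤ 1 / 8) (hz' : ‖z'‖ ≤ 1 / 8) :
    ‖c (z + z') - c z * c z'‖ * volume.real (ball (0 : V) (1 / 8)) ≤ 3 * τ := by
  refine norm_mul_measureReal_ball_le (by positivity) ?_
  have hsub : ball (0 : V) (1 / 8) ⊆ ball 0 (1 / 4) := ball_subset_ball (by norm_num)
  calc ∫⁻ u in ball (0 : V) (1 / 8), ‖c (z + z') - c z * c z'‖ₑ
      ≤ ∫⁻ u in ball (0 : V) (1 / 8), (‖h (u + (z + z')) - c (z + z') * h u‖ₑ +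
          (‖h ((u + z) + z') - c z' * h (u + z)‖ₑ + ‖h (u + z) - c z * h u‖ₑ)) := by
        refine lintegral_mono fun u => ?_
        simp only [← ofReal_norm]
        rw [← ENNReal.ofReal_add (norm_nonneg _) (norm_nonneg _),
          ← ENNReal.ofReal_add (norm_nonneg _) (by positivity)]
        refine ENNReal.ofReal_le_ofReal ?_
        have e : (c (z + z') - c z * c z') * h u = -(h (u + (z + z')) - c (z + z') * h u) +
            ((h ((u + z) + z') - c z' * h (u + z)) + c z' * (h (u + z) - c z * h u)) := by
          rw [← add_assoc u z z']; ring
        have h2 : ‖c (z + z') - c z * c z'‖ = ‖(c (z + z') - c z * c z') * h u‖ := by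
          rw [norm_mul, h1, mul_one]
        rw [h2, e]
        refine (norm_add_le _ _).trans ?_
        rw [norm_neg]
        gcongr
        refine (norm_add_le _ _).trans ?_
        gcongr
        rw [norm_mul, hc1 z' (by linarith), one_mul]
    _ = (∫⁻ u in ball (0 : V) (1 / 8), ‖h (u + (z + z')) - c (z + z') * h u‖ₑ) +
        ((∫⁻ u in ball (0 : V) (1 / 8), ‖h ((u + z) + z') - c z' * h (u + z)‖ₑ) +
          ∫⁻ u in ball (0 : V) (1 / 8), ‖h (u + z) - c z * h u‖ₑ) := by
        rw [lintegral_add_left (by fun_prop), lintegral_add_left (by fun_prop)]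
    _ ≤ ENNReal.ofReal τ + (ENNReal.ofReal τ + ENNReal.ofReal τ) := by
        gcongr
        · exact (lintegral_mono_set hsub).trans (hc _ (by linarith [norm_add_le z z']))
        · refine (setLIntegral_add_right_le (F := fun u => ‖h (u + z') - c z' * h u‖ₑ)
            measurableSet_ball measurableSet_ball fun u hu => ?_).trans (hc z' (by linarith))
          rw [mem_ball_zero_iff] at hu ⊢
          linarith [norm_add_le u z]
        · exact (lintegral_mono_set hsub).trans (hc _ (by linarith))
    _ = _ := by
        rw [← ENNReal.ofReal_add hτ hτ, ← ENNReal.ofReal_add hτ (by positivity)]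
        congr 1; ring

end Translations

/-! ### Hyers–Ulam stability of additive and multiplicative functions -/

section ApproximatelyAdditive

open Real

variable {V : Type*} [NormedAddCommGroup V] [InnerProductSpace ℝ V] [FiniteDimensional ℝ V]

/-- A bounded approximately additive function on an interval that vanishes at the end is small. -/
theorem abs_le_of_approx_additive {F : ℝ → ℝ} {r η M : ℝ} (hr : 0 < r)
    (hM : ∀ t, |t| ≤ r → |F t| ≤ M)
    (hF : ∀ s t, |s| ≤ r → |t| ≤ r → |s + t| ≤ r → |F (s + t) - F s - F t| ≤ η) (hFr : F r = 0)
    {t : ℝ} (ht : |t| ≤ r) : |F t| ≤ 5 * η := by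
  -- Doubling `t` halves a bound on `[0, r/2]`; since `F r = 0`, the reflection `t ↦ r - t` carries
  -- it to the other half. Applied to the finite supremum this gives `sup ≤ sup / 2 + 3η / 2`, so
  -- `sup ≤ 3η`.
  have halve : ∀ B, (∀ t, 0 ≤ t → t ≤ r → |F t| ≤ B) →
      ∀ t, 0 ≤ t → t ≤ r → |F t| ≤ B / 2 + 3 / 2 * η := by
    intro B hB t ht0 htr
    have hhalf : ∀ t, 0 ≤ t → t ≤ r / 2 → |F t| ≤ (B + η) / 2 := by
      intro t ht0 htr
      have h1 := hF t t (by rw [abs_of_nonneg ht0]; linarith) (by rw [abs_of_nonneg ht0]; linarith)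
        (by rw [abs_of_nonneg (by linarith)]; linarith)
      have h2 := hB (t + t) (by linarith) (by linarith)
      rw [abs_le] at h1 h2 ⊢
      constructor <;> linarith [h1.1, h1.2, h2.1, h2.2]
    have hη : 0 ≤ η := (abs_nonneg _).trans
      (hF 0 0 (by simpa using hr.le) (by simpa using hr.le) (by simpa using hr.le))
    rcases le_total t (r / 2) with h | h
    · linarith [hhalf t ht0 h]
    · have h1 := hF t (r - t) (by rwa [abs_of_nonneg ht0])
        (by rw [abs_of_nonneg (by linarith)]; linarith)
        (by rw [abs_of_nonneg (by linarith)]; linarith)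
      have h2 := hhalf (r - t) (by linarith) (by linarith)
      rw [add_sub_cancel, hFr] at h1
      rw [abs_le] at h1 h2 ⊢
      constructor <;> linarith [h1.1, h1.2, h2.1, h2.2]
  have hpos : ∀ t, 0 ≤ t → t ≤ r → |F t| ≤ 3 * η := by
    set S := (fun t => |F t|) '' Set.Icc 0 r with hS
    have hbdd : BddAbove S := ⟨M, by
      rintro _ ⟨t, ⟨h0, h1⟩, rfl⟩
      exact hM t (by rwa [abs_of_nonneg h0])⟩
    have hne : S.Nonempty := ⟨_, 0, ⟨le_rfl, hr.le⟩, rfl⟩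
    have h1 : ∀ t, 0 ≤ t → t ≤ r → |F t| ≤ sSup S := fun t h0 h1 => le_csSup hbdd ⟨t, ⟨h0, h1⟩, rfl⟩
    have h2 : sSup S ≤ sSup S / 2 + 3 / 2 * η := csSup_le hne (by
      rintro _ ⟨t, ⟨h0, hr⟩, rfl⟩
      exact halve _ h1 t h0 hr)
    intro t h0 hr
    linarith [h1 t h0 hr]
  have h0 := hF 0 0 (by simpa using hr.le) (by simpa using hr.le) (by simpa using hr.le)
  have hη : 0 ≤ η := (abs_nonneg _).trans h0
  rcases le_total 0 t with h | h
  · rw [abs_of_nonneg h] at ht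
    linarith [hpos t h ht]
  · have h1 := hF t (-t) ht (by rwa [abs_neg]) (by simpa using hr.le)
    rw [abs_of_nonpos h] at ht
    have h2 := hpos (-t) (by linarith) ht
    rw [add_neg_cancel] at h1
    rw [add_zero] at h0
    rw [abs_le] at h0 h1 h2 ⊢
    constructor <;> linarith [h0.1, h0.2, h1.1, h1.2, h2.1, h2.2]

omit [FiniteDimensional ℝ V] in
-- Bessel's inequality. It keeps partial coordinate sums inside the ball where approximate
-- additivity is available.
theorem Orthonormal.norm_sum_inner_smul_le {ι : Type*} {b : ι → V} (hb : Orthonormal ℝ b)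
    (s : Finset ι) (x : V) : ‖∑ i ∈ s, inner ℝ (b i) x • b i‖ ≤ ‖x‖ := by
  refine le_of_sq_le_sq ?_ (norm_nonneg _)
  rw [← real_inner_self_eq_norm_sq, hb.inner_sum]
  refine le_trans (le_of_eq ?_) (hb.sum_inner_products_le x (s := s))
  refine Finset.sum_congr rfl fun i _ => ?_
  simp [pow_two]

/-- A bounded approximately additive function on a ball is close to a linear form. -/
theorem exists_linear_of_approx_additive {θ : V → ℝ} {ρ η M : ℝ} (hρ : 0 < ρ)
    (hM : ∀ z, ‖z‖ ≤ ρ → |θ z| ≤ M)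
    (hθ : ∀ z z', ‖z‖ ≤ ρ → ‖z'‖ ≤ ρ → ‖z + z'‖ ≤ ρ → |θ (z + z') - θ z - θ z'| ≤ η) :
    ∃ ℓ : V →ₗ[ℝ] ℝ, ∀ z, ‖z‖ ≤ ρ →
      |θ z - ℓ z| ≤ (1 + 6 * Module.finrank ℝ V) * η := by
  set b := stdOrthonormalBasis ℝ V with hb
  -- The linear form that agrees with `θ` at the endpoints `ρ • b i` of the axes.
  set ℓ : V →ₗ[ℝ] ℝ := ∑ i, (θ (ρ • b i) / ρ) • (innerₗ V (b i)) with hℓ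
  have hℓb : ∀ i, ℓ (b i) = θ (ρ • b i) / ρ := by
    intro i
    simp only [hℓ, LinearMap.sum_apply, LinearMap.smul_apply, innerₗ_apply_apply, smul_eq_mul]
    rw [Finset.sum_eq_single i]
    · rw [real_inner_self_eq_norm_sq, b.orthonormal.1 i]; simp
    · intro j _ hj
      rw [b.orthonormal.2 hj, mul_zero]
    · simp
  refine ⟨ℓ, ?_⟩
  set F : V → ℝ := fun z => θ z - ℓ z with hF
  have hFadd : ∀ z z', ‖z‖ ≤ ρ → ‖z'‖ ≤ ρ → ‖z + z'‖ ≤ ρ → |F (z + z') - F z - F z'| ≤ η := by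
    intro z z' h1 h2 h3
    have : F (z + z') - F z - F z' = θ (z + z') - θ z - θ z' := by
      simp only [hF, map_add]; ring
    rw [this]
    exact hθ z z' h1 h2 h3
  have hη : 0 ≤ η := (abs_nonneg _).trans
    (hθ 0 0 (by simpa using hρ.le) (by simpa using hρ.le) (by simpa using hρ.le))
  have hn : ∀ (i) (t : ℝ), ‖t • b i‖ = |t| := fun i t => by
    rw [norm_smul, b.orthonormal.1 i, mul_one, norm_eq_abs]
  have hline : ∀ i t, |t| ≤ ρ → |F (t • b i)| ≤ 5 * η := by
    intro i t ht
    have hθb : |θ (ρ • b i)| ≤ M := hM _ (by rw [hn, abs_of_pos hρ])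
    refine abs_le_of_approx_additive (F := fun t => F (t • b i)) (M := 2 * M) hρ ?_ ?_ ?_ ht
    · intro t ht
      have h1 := hM (t • b i) (by rwa [hn])
      have h2 : |ℓ (t • b i)| ≤ M := by
        rw [map_smul, hℓb, smul_eq_mul, abs_mul, abs_div, abs_of_pos hρ, ← mul_div_assoc,
          div_le_iff₀ hρ, mul_comm]
        exact mul_le_mul hθb ht (abs_nonneg _) ((abs_nonneg _).trans hθb)
      exact (abs_sub _ _).trans (by linarith)
    · intro s t hs ht hst
      simp only [add_smul]
      exact hFadd _ _ (by rwa [hn]) (by rwa [hn]) (by rwa [← add_smul, hn])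
    · simp only [hF, map_smul, hℓb, smul_eq_mul]
      field_simp
      ring
  intro z hz
  -- The empty sum costs `|F 0| ≤ η`; each further coordinate costs `η` for additivity and `5η` on
  -- its axis.
  have hsum : ∀ s : Finset (Fin (Module.finrank ℝ V)),
      |F (∑ i ∈ s, inner ℝ (b i) z • b i)| ≤ (1 + 6 * s.card) * η := by
    intro s
    induction s using Finset.induction_on with
    | empty =>
      have := hFadd 0 0 (by simpa using hρ.le) (by simpa using hρ.le) (by simpa using hρ.le)
      simp only [add_zero, sub_self, zero_sub, abs_neg] at this
      simpa using this
    | insert i s his ih =>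
      have hle := fun s => (b.orthonormal.norm_sum_inner_smul_le s z).trans hz
      have e := Finset.sum_insert (f := fun i => inner ℝ (b i) z • b i) his
      have hiz : |inner ℝ (b i) z| ≤ ρ := by
        have := hle {i}
        rwa [Finset.sum_singleton, hn] at this
      have h1 := hFadd (inner ℝ (b i) z • b i) (∑ i ∈ s, inner ℝ (b i) z • b i)
        (by rwa [hn]) (hle s) (by rw [← e]; exact hle _)
      have h2 := hline i _ hiz
      rw [← e] at h1
      rw [Finset.card_insert_of_notMem his]
      push_cast
      rw [abs_le] at h1 h2 ih ⊢
      constructor <;> linarith [h1.1, h1.2, h2.1, h2.2, ih.1, ih.2]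
  have := hsum Finset.univ
  rw [Finset.card_univ, Fintype.card_fin] at this
  have e : ∑ i, inner ℝ (b i) z • b i = z := b.sum_repr' z
  rwa [e] at this

/-- The chord has length `2 |sin (t / 2)|`, which Jordan's inequality bounds below by `2 |t| / π`;
then `π ≤ 4`. -/
theorem abs_le_two_mul_norm_exp_sub_one {t : ℝ} (ht : |t| ≤ π) :
    |t| ≤ 2 * ‖Complex.exp (Complex.I * t) - 1‖ := by
  rw [Complex.norm_exp_I_mul_ofReal_sub_one, norm_mul, norm_eq_abs, norm_eq_abs, abs_two]
  have h := mul_abs_le_abs_sin (x := t / 2) (by rw [abs_div, abs_two]; linarith)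
  rw [abs_div, abs_two] at h
  have h2 : 2 / π * (|t| / 2) = |t| / π := by ring
  rw [h2, div_le_iff₀ pi_pos] at h
  nlinarith [pi_le_four, abs_nonneg (sin (t / 2))]

theorem norm_exp_I_mul_sub_exp_I_mul_le (s t : ℝ) :
    ‖Complex.exp (Complex.I * s) - Complex.exp (Complex.I * t)‖ ≤ |s - t| := by
  have e : Complex.exp (Complex.I * s) - Complex.exp (Complex.I * t) =
      Complex.exp (Complex.I * t) * (Complex.exp (Complex.I * ((s - t : ℝ) : ℂ)) - 1) := by
    rw [mul_sub, ← Complex.exp_add, mul_one]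
    congr 2
    push_cast; ring
  rw [e, norm_mul, mul_comm Complex.I, Complex.norm_exp_ofReal_mul_I, one_mul]
  exact norm_exp_I_mul_ofReal_sub_one_le

/-- A unimodular function near `1` on a ball that is nearly multiplicative is close to a
character. -/
theorem exists_linear_of_approx_multiplicative {c : V → ℂ} {ρ η : ℝ} (hρ : 0 < ρ)
    (hc1 : ∀ z, ‖z‖ ≤ ρ → ‖c z‖ = 1) (hc : ∀ z, ‖z‖ ≤ ρ → ‖c z - 1‖ ≤ 1 / 2)
    (hmul : ∀ z z', ‖z‖ ≤ ρ → ‖z'‖ ≤ ρ → ‖z + z'‖ ≤ ρ → ‖c (z + z') - c z * c z'‖ ≤ η) :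
    ∃ ℓ : V →ₗ[ℝ] ℝ, ∀ z, ‖z‖ ≤ ρ →
      ‖c z - Complex.exp (Complex.I * (ℓ z : ℂ))‖ ≤ (2 + 12 * Module.finrank ℝ V) * η := by
  have hexp : ∀ z, ‖z‖ ≤ ρ → Complex.exp (Complex.I * (Complex.arg (c z) : ℂ)) = c z := by
    intro z hz
    have := Complex.norm_mul_exp_arg_mul_I (c z)
    rwa [hc1 z hz, Complex.ofReal_one, one_mul, mul_comm] at this
  have harg : ∀ z, ‖z‖ ≤ ρ → |Complex.arg (c z)| ≤ 1 := by
    intro z hz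
    have := abs_le_two_mul_norm_exp_sub_one (Complex.abs_arg_le_pi (c z))
    rw [hexp z hz] at this
    linarith [hc z hz]
  obtain ⟨ℓ, hℓ⟩ := exists_linear_of_approx_additive (θ := fun z => Complex.arg (c z)) (η := 2 * η)
    hρ harg fun z z' hz hz' hzz => by
      have h1 := abs_le.1 (harg z hz)
      have h2 := abs_le.1 (harg z' hz')
      have h3 := abs_le.1 (harg _ hzz)
      -- Three arguments of size at most `1` combine to at most `3 < π`, so no multiple of `2π`
      -- intervenes.
      refine (abs_le_two_mul_norm_exp_sub_one (abs_le.2 ⟨?_, ?_⟩)).trans ?_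
      · linarith [pi_gt_three]
      · linarith [pi_gt_three]
      · have e : Complex.exp (Complex.I *
            ((Complex.arg (c (z + z')) - Complex.arg (c z) - Complex.arg (c z') : ℝ) : ℂ)) =
            c (z + z') / (c z * c z') := by
          push_cast
          rw [mul_sub, mul_sub, Complex.exp_sub, Complex.exp_sub, hexp z hz, hexp z' hz',
            hexp _ hzz, div_div]
        have hne : c z * c z' ≠ 0 := norm_ne_zero_iff.1 (by rw [norm_mul, hc1 z hz, hc1 z' hz']; simp)
        rw [e, div_sub_one hne, norm_div, norm_mul, hc1 z hz, hc1 z' hz', mul_one, div_one]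
        gcongr
        exact hmul z z' hz hz' hzz
  refine ⟨ℓ, fun z hz => ?_⟩
  nth_rewrite 1 [← hexp z hz]
  refine (norm_exp_I_mul_sub_exp_I_mul_le _ _).trans ((hℓ z hz).trans (le_of_eq ?_))
  ring

end ApproximatelyAdditive

/-! ### A large Fourier coefficient and its consequences -/

section LocalCharacter

open Filter Topology Metric ComplexConjugate

variable {V : Type*} [NormedAddCommGroup V] [InnerProductSpace ℝ V] [MeasurableSpace V]
  [BorelSpace V] [FiniteDimensional ℝ V]

set_option linter.unusedSectionVars false

theorem integral_norm_sub_le_of_lintegral {f : V → ℂ} (S : Set V)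
    {τ : ℝ} (hτ : 0 ≤ τ) (h : ∫⁻ u in S, ‖f u‖ₑ ≤ ENNReal.ofReal τ) :
    ‖∫ u in S, f u‖ ≤ τ := by
  have h2 := (enorm_integral_le_lintegral_enorm (μ := volume.restrict S) f).trans h
  rw [← ofReal_norm] at h2
  exact (ENNReal.ofReal_le_ofReal_iff hτ).1 h2

/-- The correlation is close to `conj c` times the measure of the overlap, and the overlap contains
the ball of radius `1/8` about `-z / 2`. -/
theorem le_norm_autocorr_indicator {h : V → ℂ} (hm : Measurable h) (h1 : ∀ x, ‖h x‖ = 1)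
    {c : ℂ} (hc1 : ‖c‖ = 1) {τ : ℝ} (hτ : 0 ≤ τ) {z : V} (hz : ‖z‖ ≤ 1 / 4)
    (hc : ∫⁻ u in ball (0 : V) (1 / 4), ‖h (u + z) - c * h u‖ₑ ≤ ENNReal.ofReal τ) :
    volume.real (ball (0 : V) (1 / 8)) - τ ≤
      ‖autocorr ((ball (0 : V) (1 / 4)).indicator h) (-z)‖ := by
  set S := ball (0 : V) (1 / 4) ∩ (fun s => s + z) ⁻¹' ball (0 : V) (1 / 4) with hS
  have hSm : MeasurableSet S :=
    measurableSet_ball.inter (measurableSet_ball.preimage (measurable_add_const z))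
  have hSfin : volume S ≠ ⊤ := (measure_ball_lt_top.trans_le'
    (measure_mono Set.inter_subset_left)).ne
  have hX : autocorr ((ball (0 : V) (1 / 4)).indicator h) (-z) =
      ∫ s in S, h s * conj (h (s + z)) := by
    rw [autocorr_neg, ← integral_indicator hSm]
    congr with s
    by_cases hs1 : s ∈ ball (0 : V) (1 / 4) <;> by_cases hs2 : s + z ∈ ball (0 : V) (1 / 4)
    · rw [Set.indicator_of_mem hs1, Set.indicator_of_mem hs2,
        Set.indicator_of_mem (show s ∈ S from ⟨hs1, hs2⟩)]
    · rw [Set.indicator_of_notMem hs2, Set.indicator_of_notMem (fun h : s ∈ S => hs2 h.2)]; simp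
    · rw [Set.indicator_of_notMem hs1, Set.indicator_of_notMem (fun h : s ∈ S => hs1 h.1)]; simp
    · rw [Set.indicator_of_notMem hs1, Set.indicator_of_notMem (fun h : s ∈ S => hs1 h.1)]; simp
  have hgi : IntegrableOn (fun s => h s * conj (h (s + z))) S :=
    Measure.integrableOn_of_bounded (M := 1) hSfin
      (show Measurable fun s => h s * conj (h (s + z)) by fun_prop).aestronglyMeasurable
      (Eventually.of_forall fun s => by simp [h1])
  have hci : IntegrableOn (fun _ : V => conj c) S := integrableOn_const hSfin
  have hdiff : ‖∫ s in S, (h s * conj (h (s + z)) - conj c)‖ ≤ τ := by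
    refine integral_norm_sub_le_of_lintegral S hτ (le_trans ?_ hc)
    refine le_trans (lintegral_mono fun s => ?_) (lintegral_mono_set Set.inter_subset_left)
    rw [← ofReal_norm, ← ofReal_norm]
    refine ENNReal.ofReal_le_ofReal (le_of_eq ?_)
    have e : h s * conj (h (s + z)) - conj c = h s * conj (h (s + z) - c * h s) := by
      rw [map_sub, map_mul, mul_sub, mul_left_comm, Complex.mul_conj', h1]
      simp
    rw [e, norm_mul, h1, one_mul, RCLike.norm_conj]
  have hSle : volume.real (ball (0 : V) (1 / 8)) ≤ volume.real S := by
    have h2 : volume.real (ball (0 : V) (1 / 8)) = volume.real (ball ((-1 / 2 : ℝ) • z) (1 / 8)) := by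
      simp only [Measure.real, Measure.addHaar_ball_center volume ((-1 / 2 : ℝ) • z)]
    have hn : ‖(1 / 2 : ℝ) • z‖ ≤ 1 / 8 := by
      rw [norm_smul]; norm_num; linarith
    rw [h2]
    refine measureReal_mono (fun x hx => ?_) hSfin
    rw [mem_ball, dist_eq_norm] at hx
    refine ⟨?_, ?_⟩
    · rw [mem_ball_zero_iff, show x = (x - (-1 / 2 : ℝ) • z) - (1 / 2 : ℝ) • z by module]
      linarith [norm_sub_le (x - (-1 / 2 : ℝ) • z) ((1 / 2 : ℝ) • z)]
    · rw [Set.mem_preimage, mem_ball_zero_iff,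
        show x + z = (x - (-1 / 2 : ℝ) • z) + (1 / 2 : ℝ) • z by module]
      linarith [norm_add_le (x - (-1 / 2 : ℝ) • z) ((1 / 2 : ℝ) • z)]
  rw [integral_sub hgi hci, ← hX] at hdiff
  have h3 : ‖∫ _ in S, conj c‖ = volume.real S := by
    simp [hc1]
  have h4 := norm_sub_norm_le (∫ _ in S, conj c) (autocorr ((ball (0 : V) (1 / 4)).indicator h) (-z))
  rw [h3, norm_sub_rev] at h4
  linarith

/-- A nearly multiplicative unimodular function has a large Fourier coefficient on a ball. -/
theorem exists_le_norm_fourier_indicator {h : V → ℂ} (hm : Measurable h) (h1 : ∀ x, ‖h x‖ = 1)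
    {c : V → ℂ} {τ : ℝ} (hτ : 0 ≤ τ) (hτ' : τ ≤ volume.real (ball (0 : V) (1 / 8)) / 2)
    (hc1 : ∀ z, ‖z‖ ≤ 1 / 4 → ‖c z‖ = 1)
    (hc : ∀ z, ‖z‖ ≤ 1 / 4 → ∫⁻ u in ball (0 : V) (1 / 4), ‖h (u + z) - c z * h u‖ₑ ≤
      ENNReal.ofReal τ) :
    ∃ ξ, volume.real (ball (0 : V) (1 / 8)) / 4 ≤
      ‖𝓕 ((ball (0 : V) (1 / 4)).indicator h) ξ‖ := by
  set v8 := volume.real (ball (0 : V) (1 / 8)) with hv8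
  set v4 := volume.real (ball (0 : V) (1 / 4)) with hv4
  have hv80 : 0 < v8 := measureReal_ball_pos _ (by norm_num)
  have hv40 : 0 < v4 := measureReal_ball_pos _ (by norm_num)
  set f := (ball (0 : V) (1 / 4)).indicator h with hf
  have hfi : Integrable f := integrable_ball_indicator hm h1 _
  have hf1 : ∀ x, ‖f x‖ ≤ 1 := fun x => (norm_indicator_le h1 _ x).trans (indicator_one_le_one _ x)
  -- If every coefficient were below `v8 / 4`, Plancherel applied to the autocorrelation and to `f`
  -- would give `∫ |autocorr f|² = ∫ |f̂|⁴ ≤ (v8 / 4)² v4`. The autocorrelation exceeds `v8 / 2` on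
  -- a ball of volume `v4`, which contradicts this.
  by_contra! hlt
  have ha : ∀ z ∈ ball (0 : V) (1 / 4), v8 / 2 ≤ ‖autocorr f z‖ := by
    intro z hz
    rw [mem_ball_zero_iff] at hz
    have hz' : ‖-z‖ ≤ 1 / 4 := by rw [norm_neg]; exact hz.le
    have := le_norm_autocorr_indicator hm h1 (hc1 (-z) hz') hτ hz' (hc (-z) hz')
    rw [neg_neg] at this
    linarith
  have hai := integrable_autocorr hfi
  have hab := norm_autocorr_le hfi hf1
  have hpl := integral_norm_fourier_sq hai hab
  have hpl2 := integral_norm_fourier_sq hfi hf1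
  have hsq : Integrable fun x => ‖autocorr f x‖ ^ 2 := by
    have := hai.norm.mul_bdd (c := (∫ x, ‖f x‖) * 1) hai.norm.aestronglyMeasurable
      (Eventually.of_forall fun x => by rw [norm_norm]; exact hab x)
    exact this.congr (Eventually.of_forall fun x => (pow_two _).symm)
  have hlow : (v8 / 2) ^ 2 * v4 ≤ ∫ x, ‖autocorr f x‖ ^ 2 := by
    calc (v8 / 2) ^ 2 * v4 = ∫ x in ball (0 : V) (1 / 4), (v8 / 2) ^ 2 := by simp [hv4, mul_comm]
      _ ≤ ∫ x in ball (0 : V) (1 / 4), ‖autocorr f x‖ ^ 2 := by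
        refine setIntegral_mono_on (integrableOn_const measure_ball_lt_top.ne) hsq.integrableOn
          measurableSet_ball fun x hx => ?_
        gcongr
        exact ha x hx
      _ ≤ _ := setIntegral_le_integral hsq (Eventually.of_forall fun x => by positivity)
  have hf2 : ∫ x, ‖f x‖ ^ 2 = v4 := by
    rw [hv4, ← integral_indicator_one measurableSet_ball]
    congr with x
    by_cases hx : x ∈ ball (0 : V) (1 / 4)
    · rw [hf, Set.indicator_of_mem hx, Set.indicator_of_mem hx, h1, one_pow]; rfl
    · rw [hf, Set.indicator_of_notMem hx, Set.indicator_of_notMem hx]; simp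
  have hup : ∫ ξ, ‖𝓕 (autocorr f) ξ‖ ^ 2 ≤ (v8 / 4) ^ 2 * v4 := by
    rw [← hf2, ← hpl2, ← integral_const_mul]
    have i1 := integrable_norm_fourier_pow hfi hf1 0
    have i2 := integrable_norm_fourier_pow hai hab 0
    refine integral_mono i2 (i1.const_mul _) fun ξ => ?_
    rw [fourier_autocorr hfi, Complex.norm_real, norm_pow, norm_norm]
    rw [pow_two (‖𝓕 f ξ‖ ^ 2)]
    gcongr
    exact (hlt ξ).le
  rw [hpl] at hup
  have : 0 < v8 ^ 2 * v4 := by positivity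
  nlinarith

/-- The integral of `h (u + z)` over the ball is close to `c` times that of `h`, and also to that of
`h` itself, since translating the ball only changes a symmetric difference. Hence `c` is near `1` if
the mean of `h` is not small. -/
theorem norm_sub_one_mul_norm_integral_le {h : V → ℂ} (hm : Measurable h) (h1 : ∀ x, ‖h x‖ = 1)
    {c : ℂ} {τ : ℝ} (hτ : 0 ≤ τ) {z : V}
    (hc : ∫⁻ u in ball (0 : V) (1 / 4), ‖h (u + z) - c * h u‖ₑ ≤ ENNReal.ofReal τ) :
    ‖c - 1‖ * ‖∫ u in ball (0 : V) (1 / 4), h u‖ ≤ τ +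
      2 * (‖autocorr (ballInd V (1 / 4)) 0‖ - ‖autocorr (ballInd V (1 / 4)) z‖) := by
  set b := ball (0 : V) (1 / 4) with hb
  set e : V → ℝ := b.indicator 1 with he
  have he0 : ∀ x, 0 ≤ e x := indicator_one_nonneg _
  have hei : Integrable e := integrable_indicator_one _
  have hein : ∀ x ∈ b, e x = 1 := fun x hx => Set.indicator_of_mem hx _
  have heout : ∀ x ∉ b, e x = 0 := fun x hx => Set.indicator_of_notMem hx _
  have hint : ∀ f : V → ℂ, Measurable f → (∀ x, ‖f x‖ = 1) → IntegrableOn f b := fun f hf hf1 =>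
    Measure.integrableOn_of_bounded (M := 1) measure_ball_lt_top.ne hf.aestronglyMeasurable
      (Eventually.of_forall fun s => (hf1 s).le)
  have i0 := hint h hm h1
  have i1 := hint (fun u => h (u + z)) (by fun_prop) fun u => h1 _
  have hA : ‖(∫ u in b, h (u + z)) - c * ∫ u in b, h u‖ ≤ τ := by
    rw [← integral_const_mul, ← integral_sub i1 (i0.const_mul c)]
    exact integral_norm_sub_le_of_lintegral _ hτ hc
  have hB : ‖(∫ u in b, h (u + z)) - ∫ u in b, h u‖ ≤
      2 * (‖autocorr (ballInd V (1 / 4)) 0‖ - ‖autocorr (ballInd V (1 / 4)) z‖) := by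
    have hG : ∀ y : V, Integrable fun u => e (u - y) * h u := fun y => by
      refine (hei.comp_sub_right y).mono' ?_ (Eventually.of_forall fun u => ?_)
      · have : Measurable e := measurable_one.indicator measurableSet_ball
        refine Measurable.aestronglyMeasurable ?_
        fun_prop
      · rw [norm_mul, h1, mul_one, Complex.norm_real, Real.norm_of_nonneg (he0 _)]
    have e1 : ∫ u in b, h (u + z) = ∫ u, e (u - z) * h u := by
      rw [← integral_add_right_eq_self (μ := volume) (fun u => (e (u - z) : ℂ) * h u) z,
        ← integral_indicator measurableSet_ball]
      congr with u
      rw [add_sub_cancel_right]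
      by_cases hu : u ∈ b
      · rw [Set.indicator_of_mem hu, hein u hu, Complex.ofReal_one, one_mul]
      · rw [Set.indicator_of_notMem hu, heout u hu, Complex.ofReal_zero, zero_mul]
    have e2 : ∫ u in b, h u = ∫ u, e (u - 0) * h u := by
      rw [← integral_indicator measurableSet_ball]
      congr with u
      rw [sub_zero]
      by_cases hu : u ∈ b
      · rw [Set.indicator_of_mem hu, hein u hu, Complex.ofReal_one, one_mul]
      · rw [Set.indicator_of_notMem hu, heout u hu, Complex.ofReal_zero, zero_mul]
    have hprod : ∀ y y' : V, Integrable fun u => e (u - y) * e (u - y') := fun y y' =>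
      (hei.comp_sub_right y).mul_bdd (c := 1) (hei.comp_sub_right y').aestronglyMeasurable
        (Eventually.of_forall fun u => by
          rw [Real.norm_of_nonneg (he0 _)]; exact indicator_one_le_one _ _)
    -- For values in `{0, 1}` the absolute difference equals its square, so it is expressed by
    -- autocorrelations.
    have hpt : ∀ x y : V, ‖(e x : ℂ) - (e y : ℂ)‖ = e x * e x - 2 * (e y * e x) + e y * e y := by
      intro x y
      rw [← Complex.ofReal_sub, Complex.norm_real]
      by_cases hx : x ∈ b <;> by_cases hy : y ∈ b <;>
        (simp [hein, heout, hx, hy]; try norm_num)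
    have hauto : ∀ y, ‖autocorr (ballInd V (1 / 4)) y‖ = ∫ u, e u * e (u - y) := fun y =>
      norm_autocorr_ofReal he0 y
    have hself : ∀ y, ∫ u, e (u - y) * e (u - y) = ∫ u, e u * e (u - 0) := fun y => by
      rw [integral_sub_right_eq_self fun u => e u * e u]
      simp
    have hsub : Integrable fun u => e (u - z) * e (u - z) - 2 * (e (u - 0) * e (u - z)) :=
      (hprod z z).sub ((hprod 0 z).const_mul 2)
    rw [e1, e2, ← integral_sub (hG z) (hG 0)]
    calc ‖∫ u, ((e (u - z) : ℂ) * h u - (e (u - 0) : ℂ) * h u)‖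
        ≤ ∫ u, ‖(e (u - z) : ℂ) * h u - (e (u - 0) : ℂ) * h u‖ := norm_integral_le_integral_norm _
      _ = ∫ u, (e (u - z) * e (u - z) - 2 * (e (u - 0) * e (u - z)) + e (u - 0) * e (u - 0)) := by
        congr with u
        rw [← sub_mul, norm_mul, h1, mul_one, hpt]
      _ = _ := by
        rw [integral_add hsub (hprod 0 0),
          integral_sub (hprod z z) ((hprod 0 z).const_mul 2), integral_const_mul, hself, hself,
          hauto, hauto]
        simp only [sub_zero]
        ring
  have e3 : (c - 1) * ∫ u in b, h u = -((∫ u in b, h (u + z)) - c * ∫ u in b, h u) +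
      ((∫ u in b, h (u + z)) - ∫ u in b, h u) := by ring
  rw [← norm_mul, e3]
  refine (norm_add_le _ _).trans ?_
  rw [norm_neg]
  exact add_le_add hA hB

end LocalCharacter

/-! ### Closeness to a character near the centre -/

section NearCharacter

open Filter Topology Metric ComplexConjugate

variable {V : Type*} [NormedAddCommGroup V] [InnerProductSpace ℝ V] [MeasurableSpace V]
  [BorelSpace V] [FiniteDimensional ℝ V]

set_option linter.unusedSectionVars false

variable (V) in
-- The translation constants are nearly multiplicative but need not be near `1`. Multiplying by the
-- character of a large Fourier coefficient makes the mean of `h` large, which brings them near `1`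
-- on a ball of fixed radius, where they have a linear phase; the modulation is then undone.
theorem exists_linear_translation :
    ∃ C r ε₀ : ℝ, 0 < C ∧ 0 < r ∧ r ≤ 1 / 8 ∧ 0 < ε₀ ∧ ∀ (h φ : V → ℂ) (ε : ℝ), Measurable h →
      (∀ x, ‖h x‖ = 1) → Measurable φ → (∀ t, ‖φ t‖ ≤ 1) → 0 ≤ ε → ε ≤ ε₀ →
      ∫⁻ t in ball (0 : V) 1, transDefect h φ t ≤ ENNReal.ofReal ε →
      ∃ ℓ : V →ₗ[ℝ] ℝ, ∀ z, ‖z‖ ≤ r →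
        ∫⁻ u in ball (0 : V) (1 / 4), ‖h (u + z) - Complex.exp (Complex.I * (ℓ z : ℂ)) * h u‖ₑ ≤
          ENNReal.ofReal (C * ε) := by
  set v8 := volume.real (ball (0 : V) (1 / 8)) with hv8
  set v4 := volume.real (ball (0 : V) (1 / 4)) with hv4
  have hv80 : 0 < v8 := measureReal_ball_pos _ (by norm_num)
  have hv40 : 0 < v4 := measureReal_ball_pos _ (by norm_num)
  have hcont : Continuous fun z => ‖autocorr (ballInd V (1 / 4)) z‖ :=
    (continuous_autocorr (integrable_ballInd _) (norm_ballInd_le _)).norm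
  obtain ⟨ρ, hρ, hρa⟩ := Metric.continuousAt_iff.1 (hcont.continuousAt (x := (0 : V))) (v8 / 32)
    (by positivity)
  set D : ℝ := 2 + 12 * Module.finrank ℝ V with hD
  have hD0 : 0 < D := by positivity
  -- The threshold gives `τ ≤ v8 / 16` and the radius makes the autocorrelation vary by less than
  -- `v8 / 32`. Against a mean of at least `v8 / 4` these give `‖c' z - 1‖ ≤ 1/2`.
  refine ⟨4 / v4 * (1 + D * (3 / v8) * v4), min (ρ / 2) (1 / 8), v4 * v8 / 64, by positivity,
    by positivity, min_le_right _ _, by positivity, fun h φ ε hm h1 hφ hφ1 hε hε0 hd => ?_⟩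
  set τ := 4 * ε / v4 with hτ
  have hτ0 : 0 ≤ τ := by positivity
  have hτ16 : τ ≤ v8 / 16 := by
    rw [hτ, div_le_iff₀ hv40]; linarith
  have hex : ∀ z : V, ‖z‖ ≤ 1 / 4 → ∃ c : ℂ, ‖c‖ = 1 ∧
      ∫⁻ u in ball (0 : V) (1 / 4), ‖h (u + z) - c * h u‖ₑ ≤ ENNReal.ofReal τ := fun z hz =>
    exists_unimodular_translation hm h1 hφ hφ1 hε hd hz
  choose! c hc using hex
  obtain ⟨ξ, hξ⟩ := exists_le_norm_fourier_indicator hm h1 hτ0 (by linarith)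
    (fun z hz => (hc z hz).1) (fun z hz => (hc z hz).2)
  set χ : V → ℂ := fun u => (Real.fourierChar (-inner ℝ u ξ) : ℂ) with hχ
  have hχ1 : ∀ u, ‖χ u‖ = 1 := fun u => Circle.norm_coe _
  have hχadd : ∀ u z, χ (u + z) = χ u * χ z := fun u z => by
    simp only [hχ, inner_add_left, neg_add, AddChar.map_add_eq_mul, Circle.coe_mul]
  have hχm : Measurable χ := by
    refine Continuous.measurable ?_
    exact continuous_subtype_val.comp (Real.continuous_fourierChar.comp (by fun_prop))
  set h' : V → ℂ := fun u => χ u * h u with hh'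
  set c' : V → ℂ := fun z => χ z * c z with hc'
  have hm' : Measurable h' := hχm.mul hm
  have h1' : ∀ x, ‖h' x‖ = 1 := fun x => by rw [hh', norm_mul, hχ1, h1, one_mul]
  have hc1' : ∀ z, ‖z‖ ≤ 1 / 4 → ‖c' z‖ = 1 := fun z hz => by
    rw [hc', norm_mul, hχ1, (hc z hz).1, one_mul]
  have hcc' : ∀ z, ‖z‖ ≤ 1 / 4 →
      ∫⁻ u in ball (0 : V) (1 / 4), ‖h' (u + z) - c' z * h' u‖ₑ ≤ ENNReal.ofReal τ := by
    intro z hz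
    refine le_trans (le_of_eq ?_) (hc z hz).2
    congr with u
    have e : h' (u + z) - c' z * h' u = χ (u + z) * (h (u + z) - c z * h u) := by
      simp only [hh', hc', hχadd]; ring
    rw [e, enorm_mul, ← ofReal_norm, hχ1, ENNReal.ofReal_one, one_mul]
  have hmean : v8 / 4 ≤ ‖∫ u in ball (0 : V) (1 / 4), h' u‖ := by
    refine hξ.trans (le_of_eq ?_)
    rw [Real.fourier_eq, ← integral_indicator measurableSet_ball]
    congr with u
    rw [hh', Set.indicator_mul_right, Circle.smul_def, smul_eq_mul]
  have hr4 : ∀ z : V, ‖z‖ ≤ min (ρ / 2) (1 / 8) → ‖z‖ ≤ 1 / 8 := fun z hz =>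
    hz.trans (min_le_right _ _)
  obtain ⟨ℓ, hℓ⟩ := exists_linear_of_approx_multiplicative (c := c') (ρ := min (ρ / 2) (1 / 8))
    (η := 3 * τ / v8) (by positivity) (fun z hz => hc1' z (by linarith [hr4 z hz]))
    (fun z hz => by
      have h2 := norm_sub_one_mul_norm_integral_le hm' h1' hτ0 (hcc' z (by linarith [hr4 z hz]))
      have h3 := hρa (x := z) (by
        rw [dist_zero_right]
        linarith [hz.trans (min_le_left _ _)])
      rw [Real.dist_eq, abs_lt] at h3
      have h4 : ‖c' z - 1‖ * (v8 / 4) ≤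
          ‖c' z - 1‖ * ‖∫ u in ball (0 : V) (1 / 4), h' u‖ := by gcongr
      have h5 : ‖c' z - 1‖ * (v8 / 4) ≤ 1 / 2 * (v8 / 4) := by linarith [h3.1]
      exact le_of_mul_le_mul_right h5 (by positivity))
    (fun z z' hz hz' _ => by
      rw [le_div_iff₀ hv80]
      exact norm_translation_const_sub_mul_le hm' h1' hτ0 hc1' hcc' (hr4 z hz) (hr4 z' hz'))
  refine ⟨ℓ + (2 * Real.pi) • (innerₗ V ξ), fun z hz => ?_⟩
  have hz4 : ‖z‖ ≤ 1 / 4 := by linarith [hr4 z hz]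
  set E := Complex.exp (Complex.I * ((ℓ + (2 * Real.pi) • (innerₗ V ξ)) z : ℝ)) with hE
  have hχE : χ z * E = Complex.exp (Complex.I * (ℓ z : ℂ)) := by
    have e1 : χ z = Complex.exp (((2 * Real.pi * -inner ℝ z ξ : ℝ) : ℂ) * Complex.I) :=
      Real.fourierChar_apply _
    rw [hE, e1, ← Complex.exp_add]
    congr 1
    simp only [LinearMap.add_apply, LinearMap.smul_apply, innerₗ_apply_apply, smul_eq_mul,
      real_inner_comm z ξ]
    push_cast
    ring
  have hcE : ‖c z - E‖ ≤ D * (3 * τ / v8) := by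
    have : ‖c z - E‖ = ‖c' z - Complex.exp (Complex.I * (ℓ z : ℂ))‖ := by
      rw [← hχE, hc', ← mul_sub, norm_mul, hχ1, one_mul]
    rw [this]
    exact hℓ z hz
  calc ∫⁻ u in ball (0 : V) (1 / 4), ‖h (u + z) - E * h u‖ₑ
      ≤ ∫⁻ u in ball (0 : V) (1 / 4), (‖h (u + z) - c z * h u‖ₑ +
          ENNReal.ofReal (D * (3 * τ / v8))) := by
        refine lintegral_mono fun u => ?_
        have e : h (u + z) - E * h u = (h (u + z) - c z * h u) + (c z - E) * h u := by ring
        rw [e]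
        refine (enorm_add_le _ _).trans ?_
        gcongr
        rw [← ofReal_norm, norm_mul, h1, mul_one]
        exact ENNReal.ofReal_le_ofReal hcE
    _ = (∫⁻ u in ball (0 : V) (1 / 4), ‖h (u + z) - c z * h u‖ₑ) +
          ENNReal.ofReal (D * (3 * τ / v8)) * ENNReal.ofReal v4 := by
        rw [lintegral_add_right _ measurable_const, setLIntegral_const, hv4,
          ofReal_measureReal_ball]
    _ ≤ ENNReal.ofReal τ + ENNReal.ofReal (D * (3 * τ / v8)) * ENNReal.ofReal v4 := by
        gcongr
        exact (hc z hz4).2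
    _ = _ := by
        rw [← ENNReal.ofReal_mul (by positivity), ← ENNReal.ofReal_add hτ0 (by positivity)]
        congr 1
        rw [hτ]
        field_simp

variable (V) in
-- After exchanging the integrals in `u` and `z`, averaging selects a base point `u` with `h v ≈ E
-- (v - u) * h u` for most `v`; the constant phase is `γ = E (-u) * h u`.
theorem exists_character_near_center :
    ∃ C r ε₀ : ℝ, 0 < C ∧ 0 < r ∧ r ≤ 1 ∧ 0 < ε₀ ∧ ∀ (h φ : V → ℂ) (ε : ℝ), Measurable h →
      (∀ x, ‖h x‖ = 1) → Measurable φ → (∀ t, ‖φ t‖ ≤ 1) → 0 ≤ ε → ε ≤ ε₀ →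
      ∫⁻ t in ball (0 : V) 1, transDefect h φ t ≤ ENNReal.ofReal ε →
      ∃ (ℓ : V →ₗ[ℝ] ℝ) (γ : ℂ), ‖γ‖ = 1 ∧
        ∫⁻ v in ball (0 : V) r, ‖h v - Complex.exp (Complex.I * (ℓ v : ℂ)) * γ‖ₑ ≤
          ENNReal.ofReal (C * ε) := by
  obtain ⟨C, r, ε₀, hC, hr, hr8, hε₀, H⟩ := exists_linear_translation V
  set a := volume.real (ball (0 : V) r) with ha
  set a2 := volume.real (ball (0 : V) (r / 2)) with ha2
  have ha0 : 0 < a := measureReal_ball_pos _ hr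
  have ha20 : 0 < a2 := measureReal_ball_pos _ (by positivity)
  refine ⟨C * a / a2, r / 2, ε₀, by positivity, by positivity, by linarith, hε₀,
    fun h φ ε hm h1 hφ hφ1 hε hε0 hd => ?_⟩
  obtain ⟨ℓ, hℓ⟩ := H h φ ε hm h1 hφ hφ1 hε hε0 hd
  have hℓc : Continuous ℓ := ℓ.continuous_of_finiteDimensional
  have hEm : Measurable fun z : V => Complex.exp (Complex.I * (ℓ z : ℂ)) :=
    (Complex.continuous_exp.comp (continuous_const.mul
      (Complex.continuous_ofReal.comp hℓc))).measurable
  set E : V → ℂ := fun z => Complex.exp (Complex.I * (ℓ z : ℂ)) with hE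
  have hEadd : ∀ x y, E (x + y) = E x * E y := fun x y => by
    simp only [hE, map_add, Complex.ofReal_add, mul_add, Complex.exp_add]
  have hE1 : ∀ x, ‖E x‖ = 1 := fun x => by
    simp only [hE]; rw [mul_comm, Complex.norm_exp_ofReal_mul_I]
  have hFm : Measurable fun p : V × V => ‖h (p.1 + p.2) - E p.2 * h p.1‖ₑ := by fun_prop
  have hG2 : Measurable fun p : V × V => ‖h p.2 - E (p.2 - p.1) * h p.1‖ₑ := by fun_prop
  obtain ⟨u, hu, hule⟩ := exists_le_setLAverage (μ := (volume : Measure V))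
    (s := ball (0 : V) (r / 2))
    (f := fun u => ∫⁻ v in ball (0 : V) (r / 2), ‖h v - E (v - u) * h u‖ₑ)
    (measure_ball_pos volume 0 (by positivity)).ne' measure_ball_lt_top.ne
    hG2.lintegral_prod_right'.aemeasurable
  refine ⟨ℓ, E (-u) * h u, by rw [norm_mul, hE1, h1, one_mul], ?_⟩
  calc ∫⁻ v in ball (0 : V) (r / 2), ‖h v - E v * (E (-u) * h u)‖ₑ
      = ∫⁻ v in ball (0 : V) (r / 2), ‖h v - E (v - u) * h u‖ₑ := by
        congr with v
        rw [sub_eq_add_neg v u, hEadd, mul_assoc]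
    _ ≤ _ := hule
    _ ≤ ENNReal.ofReal (C * ε * a / a2) := by
        rw [setLAverage_eq, ENNReal.ofReal_div_of_pos ha20, ha2, ofReal_measureReal_ball]
        gcongr
        calc ∫⁻ u in ball (0 : V) (r / 2), ∫⁻ v in ball (0 : V) (r / 2), ‖h v - E (v - u) * h u‖ₑ
            ≤ ∫⁻ u in ball (0 : V) (r / 2), ∫⁻ z in ball (0 : V) r,
                ‖h (u + z) - E z * h u‖ₑ := by
              refine setLIntegral_mono' measurableSet_ball fun u hu => ?_
              have := setLIntegral_add_right_le (A := ball (0 : V) (r / 2)) (B := ball (0 : V) r)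
                measurableSet_ball measurableSet_ball
                (fun z => ‖h (u + z) - E z * h u‖ₑ) (z := -u) fun s hs => by
                  rw [mem_ball_zero_iff] at hs hu ⊢
                  rw [← sub_eq_add_neg]
                  linarith [norm_sub_le s u]
              refine le_trans (le_of_eq ?_) this
              congr with v
              rw [← sub_eq_add_neg, add_sub_cancel]
          _ = ∫⁻ z in ball (0 : V) r, ∫⁻ u in ball (0 : V) (r / 2), ‖h (u + z) - E z * h u‖ₑ :=
              lintegral_lintegral_swap hFm.aemeasurable
          _ ≤ ∫⁻ z in ball (0 : V) r, ENNReal.ofReal (C * ε) := by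
              refine setLIntegral_mono' measurableSet_ball fun z hz => ?_
              rw [mem_ball_zero_iff] at hz
              exact (lintegral_mono_set (ball_subset_ball (by linarith))).trans (hℓ z hz.le)
          _ = ENNReal.ofReal (C * ε * a) := by
              rw [setLIntegral_const, ENNReal.ofReal_mul (p := C * ε) (by positivity), ha,
                ofReal_measureReal_ball]
    _ = _ := by congr 1; ring

end NearCharacter

/-! ### Spreading from a small ball to the unit ball -/

section Spreading

open Filter Topology Metric

variable {V : Type*} [NormedAddCommGroup V] [InnerProductSpace ℝ V] [MeasurableSpace V]
  [BorelSpace V] [FiniteDimensional ℝ V]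

set_option linter.unusedSectionVars false

/-- Averaging over translates: if every point of `A` is reached from `U` by many translations in
`T`, integrals over `A` are controlled by the integrals of the translates. -/
theorem mul_setLIntegral_le_lintegral_translates {A U T : Set V} (hA : MeasurableSet A)
    (hU : MeasurableSet U) (hT : MeasurableSet T) {G : V → ℝ≥0∞} (hG : Measurable G) {m : ℝ≥0∞}
    (hm : ∀ v ∈ A, m ≤ volume (T ∩ {t | v - t ∈ U})) :
    m * ∫⁻ v in A, G v ≤ ∫⁻ t in T, ∫⁻ u in U ∩ (fun u => u + t) ⁻¹' A, G (u + t) := by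
  have hF : Measurable fun p : V × V => T.indicator 1 p.1 * U.indicator 1 (p.2 - p.1) *
      A.indicator G p.2 := by
    have h1 : Measurable (T.indicator (1 : V → ℝ≥0∞)) := measurable_one.indicator hT
    have h2 : Measurable (U.indicator (1 : V → ℝ≥0∞)) := measurable_one.indicator hU
    have h3 := hG.indicator hA
    fun_prop
  have e1 : ∀ v, ∫⁻ t, T.indicator 1 t * U.indicator 1 (v - t) * A.indicator G v =
      volume (T ∩ {t | v - t ∈ U}) * A.indicator G v := by
    intro v
    have hTU : MeasurableSet (T ∩ {t | v - t ∈ U}) :=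
      hT.inter (hU.preimage (measurable_const_sub v))
    rw [← lintegral_indicator_one hTU, ← lintegral_mul_const _ (measurable_one.indicator hTU)]
    congr with t
    congr 1
    rw [Set.inter_indicator_one]
    rfl
  calc m * ∫⁻ v in A, G v = ∫⁻ v, m * A.indicator G v := by
        rw [← lintegral_indicator hA, lintegral_const_mul _ (hG.indicator hA)]
    _ ≤ ∫⁻ v, volume (T ∩ {t | v - t ∈ U}) * A.indicator G v := by
        refine lintegral_mono fun v => ?_
        by_cases hv : v ∈ A
        · exact mul_le_mul_left (hm v hv) _
        · simp [Set.indicator_of_notMem hv]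
    _ = ∫⁻ v, ∫⁻ t, T.indicator 1 t * U.indicator 1 (v - t) * A.indicator G v := by
        simp only [e1]
    _ = ∫⁻ t, ∫⁻ v, T.indicator 1 t * U.indicator 1 (v - t) * A.indicator G v :=
        (lintegral_lintegral_swap hF.aemeasurable).symm
    _ ≤ ∫⁻ t in T, ∫⁻ u in U ∩ (fun u => u + t) ⁻¹' A, G (u + t) := by
        rw [← lintegral_indicator hT]
        refine lintegral_mono fun t => ?_
        by_cases ht : t ∈ T
        · rw [Set.indicator_of_mem (s := T)
            (f := fun t => ∫⁻ u in U ∩ (fun u => u + t) ⁻¹' A, G (u + t)) ht, ← lintegral_add_right_eq_self _ t,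
            ← lintegral_indicator (hU.inter (hA.preimage (measurable_add_const t)))]
          refine lintegral_mono fun u => ?_
          dsimp only
          rw [add_sub_cancel_right, Set.indicator_of_mem ht, Pi.one_apply, one_mul]
          by_cases hu : u ∈ U <;> by_cases hu' : u + t ∈ A
          · rw [Set.indicator_of_mem hu, Set.indicator_of_mem hu', Set.indicator_of_mem
              (show u ∈ U ∩ (fun u => u + t) ⁻¹' A from ⟨hu, hu'⟩)]
            simp
          · rw [Set.indicator_of_notMem hu']; simp
          · rw [Set.indicator_of_notMem hu]; simp
          · rw [Set.indicator_of_notMem hu]; simp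
        · simp [Set.indicator_of_notMem ht]

theorem enorm_le_one_of_norm {x : ℂ} (h : ‖x‖ ≤ 1) : ‖x‖ₑ ≤ 1 := by
  rw [← ofReal_norm]; exact ENNReal.ofReal_le_one.2 h

/-- If `h` is near `1` on a centred ball, then its translation multiplier is near `1`. -/
theorem lintegral_multiplier_sub_one_mul_le {h φ : V → ℂ} (hm : Measurable h)
    (hφ : Measurable φ) (hφ1 : ∀ t, ‖φ t‖ ≤ 1) {s : ℝ} (hs1 : s ≤ 1)
    {ε : ℝ≥0∞} (hd : ∫⁻ t in ball (0 : V) 1, transDefect h φ t ≤ ε)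
    (hc : ∫⁻ u in ball (0 : V) s, ‖h u - 1‖ₑ ≤ ε) :
    (∫⁻ t in ball (0 : V) (s / 2), ‖φ t - 1‖ₑ) * volume (ball (0 : V) (s / 2)) ≤
      (1 + 2 * volume (ball (0 : V) (s / 2))) * ε := by
  have hpt : ∀ t ∈ ball (0 : V) (s / 2), ‖φ t - 1‖ₑ * volume (ball (0 : V) (s / 2)) ≤
      transDefect h φ t + (ε + ε) := by
    intro t ht
    rw [mem_ball_zero_iff] at ht
    rw [← setLIntegral_const]
    calc ∫⁻ u in ball (0 : V) (s / 2), ‖φ t - 1‖ₑ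
        ≤ ∫⁻ u in ball (0 : V) (s / 2), (‖h (u + t) - φ t * h u‖ₑ +
            (‖h (u + t) - 1‖ₑ + ‖h u - 1‖ₑ)) := by
          refine lintegral_mono fun u => ?_
          -- For `u` and `t` in the half-radius ball both `u` and `u + t` stay where `h` is near
          -- `1`, which pins down `φ t`.
          have e : φ t - 1 = -(h (u + t) - φ t * h u) + ((h (u + t) - 1) - φ t * (h u - 1)) := by
            ring
          rw [e]
          refine (enorm_add_le _ _).trans ?_
          rw [enorm_neg]
          gcongr
          refine enorm_sub_le.trans ?_
          gcongr
          rw [enorm_mul]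
          exact mul_le_of_le_one_left zero_le (enorm_le_one_of_norm (hφ1 t))
      _ = (∫⁻ u in ball (0 : V) (s / 2), ‖h (u + t) - φ t * h u‖ₑ) +
          ((∫⁻ u in ball (0 : V) (s / 2), ‖h (u + t) - 1‖ₑ) +
            ∫⁻ u in ball (0 : V) (s / 2), ‖h u - 1‖ₑ) := by
          rw [lintegral_add_left (by fun_prop), lintegral_add_left (by fun_prop)]
      _ ≤ _ := by
          gcongr
          · refine lintegral_mono_set fun u hu => ?_
            rw [mem_ball_zero_iff] at hu
            refine ⟨mem_ball_zero_iff.2 ?_, mem_ball_zero_iff.2 ?_⟩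
            · linarith [norm_nonneg u]
            · linarith [norm_add_le u t]
          · refine (setLIntegral_add_right_le (F := fun u => ‖h u - 1‖ₑ) measurableSet_ball
              measurableSet_ball fun u hu => ?_).trans hc
            rw [mem_ball_zero_iff] at hu ⊢
            linarith [norm_add_le u t]
          · refine (lintegral_mono_set fun u hu => ?_).trans hc
            rw [mem_ball_zero_iff] at hu ⊢
            linarith [norm_nonneg u]
  calc (∫⁻ t in ball (0 : V) (s / 2), ‖φ t - 1‖ₑ) * volume (ball (0 : V) (s / 2))
      = ∫⁻ t in ball (0 : V) (s / 2), ‖φ t - 1‖ₑ * volume (ball (0 : V) (s / 2)) :=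
        (lintegral_mul_const _ (by fun_prop)).symm
    _ ≤ ∫⁻ t in ball (0 : V) (s / 2), (transDefect h φ t + (ε + ε)) :=
        setLIntegral_mono' measurableSet_ball hpt
    _ = (∫⁻ t in ball (0 : V) (s / 2), transDefect h φ t) +
          (ε + ε) * volume (ball (0 : V) (s / 2)) := by
        rw [lintegral_add_right _ measurable_const, setLIntegral_const]
    _ ≤ ε + (ε + ε) * volume (ball (0 : V) (s / 2)) := by
        gcongr
        refine (lintegral_mono_set fun t ht => ?_).trans hd
        rw [mem_ball_zero_iff] at ht ⊢
        linarith [norm_nonneg t]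
    _ = _ := by ring

variable (V) in
/-- Nearness to `1` spreads from a ball to a larger one. -/
theorem exists_spread_step {s : ℝ} (hs : 0 < s) (hs1 : s ≤ 1) :
    ∃ C : ℝ≥0∞, C ≠ ⊤ ∧ 1 ≤ C ∧ ∀ (h φ : V → ℂ) (ε : ℝ≥0∞), Measurable h → (∀ x, ‖h x‖ = 1) →
      Measurable φ → (∀ t, ‖φ t‖ ≤ 1) → ∫⁻ t in ball (0 : V) 1, transDefect h φ t ≤ ε →
      ∫⁻ u in ball (0 : V) s, ‖h u - 1‖ₑ ≤ ε →
      ∫⁻ u in ball (0 : V) (min (5 / 4 * s) 1), ‖h u - 1‖ₑ ≤ C * ε := by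
  set w := volume (ball (0 : V) (s / 2)) with hw
  set ws := volume (ball (0 : V) s) with hws
  set m := volume (ball (0 : V) (s / 8)) with hmdef
  have hw0 : w ≠ 0 := (measure_ball_pos volume 0 (by positivity)).ne'
  have hwt : w ≠ ⊤ := measure_ball_lt_top.ne
  have hwst : ws ≠ ⊤ := measure_ball_lt_top.ne
  have hm0 : m ≠ 0 := (measure_ball_pos volume 0 (by positivity)).ne'
  have hmt : m ≠ ⊤ := measure_ball_lt_top.ne
  set K := (1 + ((1 + 2 * w) / w) * ws + w) with hK
  have hKt : K ≠ ⊤ := by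
    have : (1 + 2 * w) / w ≠ ⊤ := (ENNReal.div_lt_top (by finiteness) hw0).ne
    rw [hK]; finiteness
  refine ⟨1 + K / m, ?_, le_self_add, fun h φ ε hm h1 hφ hφ1 hd hc => ?_⟩
  · have := (ENNReal.div_lt_top hKt hm0).ne
    finiteness
  have hmul : ∫⁻ t in ball (0 : V) (s / 2), ‖φ t - 1‖ₑ ≤ (1 + 2 * w) / w * ε := by
    have := lintegral_multiplier_sub_one_mul_le hm hφ hφ1 hs1 hd hc
    rw [← ENNReal.le_div_iff_mul_le (Or.inl hw0) (Or.inl hwt)] at this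
    refine this.trans (le_of_eq ?_)
    rw [ENNReal.div_eq_inv_mul, ENNReal.div_eq_inv_mul, mul_assoc]
  have hkey : m * ∫⁻ v in ball (0 : V) (min (5 / 4 * s) 1), ‖h v - 1‖ₑ ≤ K * ε := by
    refine (mul_setLIntegral_le_lintegral_translates (U := ball (0 : V) s)
      (T := ball (0 : V) (s / 2)) measurableSet_ball measurableSet_ball measurableSet_ball
      (by fun_prop) fun v hv => ?_).trans ?_
    · rw [mem_ball_zero_iff] at hv
      have hv' := hv.trans_le (min_le_left _ _)
      -- With `‖v‖ < 5s/4`, any `t` within `s/8` of `3v/10` has `‖t‖ < 3s/8 + s/8 = s/2` and `‖v -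
      -- t‖ < 7s/8 + s/8 = s`.
      rw [hmdef, ← Measure.addHaar_ball_center volume ((3 / 10 : ℝ) • v)]
      refine measure_mono fun t ht => ?_
      rw [mem_ball, dist_eq_norm] at ht
      have n1 : ‖(3 / 10 : ℝ) • v‖ = 3 / 10 * ‖v‖ := by rw [norm_smul]; norm_num
      have n2 : ‖(7 / 10 : ℝ) • v‖ = 7 / 10 * ‖v‖ := by rw [norm_smul]; norm_num
      refine ⟨mem_ball_zero_iff.2 ?_, mem_ball_zero_iff.2 ?_⟩
      · rw [show t = (t - (3 / 10 : ℝ) • v) + (3 / 10 : ℝ) • v by module]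
        linarith [norm_add_le (t - (3 / 10 : ℝ) • v) ((3 / 10 : ℝ) • v)]
      · rw [show v - t = (7 / 10 : ℝ) • v - (t - (3 / 10 : ℝ) • v) by module]
        linarith [norm_sub_le ((7 / 10 : ℝ) • v) (t - (3 / 10 : ℝ) • v)]
    · have hpt : ∀ t, ∫⁻ u in ball (0 : V) s ∩ (fun u => u + t) ⁻¹' ball 0 (min (5 / 4 * s) 1),
          ‖h (u + t) - 1‖ₑ ≤ transDefect h φ t + (‖φ t - 1‖ₑ * ws + ε) := by
        intro t
        calc ∫⁻ u in ball (0 : V) s ∩ (fun u => u + t) ⁻¹' ball 0 (min (5 / 4 * s) 1),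
              ‖h (u + t) - 1‖ₑ
            ≤ ∫⁻ u in ball (0 : V) s ∩ (fun u => u + t) ⁻¹' ball 0 (min (5 / 4 * s) 1),
              (‖h (u + t) - φ t * h u‖ₑ + (‖φ t - 1‖ₑ + ‖h u - 1‖ₑ)) := by
              refine lintegral_mono fun u => ?_
              have e : h (u + t) - 1 = (h (u + t) - φ t * h u) + ((φ t - 1) + φ t * (h u - 1)) := by
                ring
              rw [e]
              refine (enorm_add_le _ _).trans ?_
              gcongr
              refine (enorm_add_le _ _).trans ?_
              gcongr
              rw [enorm_mul]
              exact mul_le_of_le_one_left zero_le (enorm_le_one_of_norm (hφ1 t))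
          _ = (∫⁻ u in ball (0 : V) s ∩ (fun u => u + t) ⁻¹' ball 0 (min (5 / 4 * s) 1),
                ‖h (u + t) - φ t * h u‖ₑ) +
              ((∫⁻ u in ball (0 : V) s ∩ (fun u => u + t) ⁻¹' ball 0 (min (5 / 4 * s) 1),
                ‖φ t - 1‖ₑ) +
              ∫⁻ u in ball (0 : V) s ∩ (fun u => u + t) ⁻¹' ball 0 (min (5 / 4 * s) 1),
                ‖h u - 1‖ₑ) := by
              rw [lintegral_add_left (by fun_prop), lintegral_add_left (by fun_prop)]
          _ ≤ _ := by
              gcongr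
              · exact lintegral_mono_set fun u hu => ⟨ball_subset_ball hs1 hu.1,
                  ball_subset_ball (min_le_right _ _) hu.2⟩
              · exact (lintegral_mono_set Set.inter_subset_left).trans (setLIntegral_const _ _).le
              · exact (lintegral_mono_set Set.inter_subset_left).trans hc
      calc _ ≤ ∫⁻ t in ball (0 : V) (s / 2), (transDefect h φ t + (‖φ t - 1‖ₑ * ws + ε)) :=
            lintegral_mono hpt
        _ = (∫⁻ t in ball (0 : V) (s / 2), transDefect h φ t) +
            ((∫⁻ t in ball (0 : V) (s / 2), ‖φ t - 1‖ₑ) * ws + ε * w) := by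
            rw [lintegral_add_left (measurable_transDefect hm hφ), lintegral_add_left (by fun_prop),
              lintegral_mul_const _ (by fun_prop), setLIntegral_const]
        _ ≤ ε + ((1 + 2 * w) / w * ε * ws + ε * w) := by
            gcongr
            refine (lintegral_mono_set fun t ht => ?_).trans hd
            rw [mem_ball_zero_iff] at ht ⊢
            linarith [norm_nonneg t]
        _ = K * ε := by rw [hK]; ring
  rw [mul_comm, ← ENNReal.le_div_iff_mul_le (Or.inl hm0) (Or.inl hmt)] at hkey
  refine hkey.trans ?_
  have e : K * ε / m = K / m * ε := by
    rw [ENNReal.div_eq_inv_mul, ENNReal.div_eq_inv_mul, mul_assoc]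
  rw [e]
  exact mul_le_mul_left le_add_self _

variable (V) in
-- Finitely many enlargements by the factor `5/4` reach radius `1`, their number depending only on
-- `s`.
theorem exists_spread {s : ℝ} (hs : 0 < s) (hs1 : s ≤ 1) :
    ∃ C : ℝ≥0∞, C ≠ ⊤ ∧ ∀ (h φ : V → ℂ) (ε : ℝ≥0∞), Measurable h → (∀ x, ‖h x‖ = 1) →
      Measurable φ → (∀ t, ‖φ t‖ ≤ 1) → ∫⁻ t in ball (0 : V) 1, transDefect h φ t ≤ ε →
      ∫⁻ u in ball (0 : V) s, ‖h u - 1‖ₑ ≤ ε →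
      ∫⁻ u in ball (0 : V) 1, ‖h u - 1‖ₑ ≤ C * ε := by
  have key : ∀ n : ℕ, ∃ C : ℝ≥0∞, C ≠ ⊤ ∧ 1 ≤ C ∧ ∀ (h φ : V → ℂ) (ε : ℝ≥0∞), Measurable h →
      (∀ x, ‖h x‖ = 1) → Measurable φ → (∀ t, ‖φ t‖ ≤ 1) →
      ∫⁻ t in ball (0 : V) 1, transDefect h φ t ≤ ε →
      ∫⁻ u in ball (0 : V) s, ‖h u - 1‖ₑ ≤ ε →
      ∫⁻ u in ball (0 : V) (min ((5 / 4) ^ n * s) 1), ‖h u - 1‖ₑ ≤ C * ε := by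
    intro n
    induction n with
    | zero =>
      refine ⟨1, ENNReal.one_ne_top, le_rfl, fun h φ ε _ _ _ _ _ hc => ?_⟩
      rw [pow_zero, one_mul, min_eq_left hs1, one_mul]
      exact hc
    | succ n ih =>
      obtain ⟨C, hC, hC1, H⟩ := ih
      obtain ⟨C', hC', hC1', H'⟩ := exists_spread_step V (s := min ((5 / 4) ^ n * s) 1)
        (by positivity) (min_le_right _ _)
      refine ⟨C' * C, by finiteness, one_le_mul hC1' hC1, fun h φ ε hm h1 hφ hφ1 hd hc => ?_⟩
      -- The step is applied with error `C * ε` for both hypotheses; this is why the constants are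
      -- kept at least `1`.
      have h2 := H' h φ (C * ε) hm h1 hφ hφ1 (hd.trans (le_mul_of_one_le_left' hC1))
        (H h φ ε hm h1 hφ hφ1 hd hc)
      rw [mul_assoc]
      refine le_trans (lintegral_mono_set (ball_subset_ball ?_)) h2
      refine le_min ?_ (min_le_right _ _)
      rcases le_total ((5 / 4) ^ n * s) 1 with h3 | h3
      · rw [min_eq_left h3]
        refine (min_le_left _ _).trans (le_of_eq ?_)
        ring
      · rw [min_eq_right h3]
        refine (min_le_right _ _).trans ?_
        norm_num
  obtain ⟨n, hn⟩ := pow_unbounded_of_one_lt (1 / s) (show (1 : ℝ) < 5 / 4 by norm_num)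
  obtain ⟨C, hC, -, H⟩ := key n
  rw [div_lt_iff₀ hs] at hn
  rw [min_eq_right hn.le] at H
  exact ⟨C, hC, H⟩

variable (V) in
/-- **Stability of characters**: a unimodular function on the unit ball that is nearly
multiplicative under translations is close to an affine phase. -/
theorem exists_affine_phase_of_transDefect :
    ∃ C : ℝ, 0 < C ∧ ∀ (h φ : V → ℂ) (ε : ℝ), Measurable h → (∀ x, ‖h x‖ = 1) → Measurable φ →
      (∀ t, ‖φ t‖ ≤ 1) → 0 < ε →
      ∫⁻ t in ball (0 : V) 1, transDefect h φ t ≤ ENNReal.ofReal ε →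
      ∃ L : V →ᵃ[ℝ] ℝ, ∫⁻ x in ball (0 : V) 1, ‖Complex.exp (Complex.I * (L x : ℂ)) - h x‖ₑ ≤
        ENNReal.ofReal (C * ε) := by
  obtain ⟨C₁, r, ε₀, hC₁, hr, hr1, hε₀, H⟩ := exists_character_near_center V
  obtain ⟨C₂, hC₂, H₂⟩ := exists_spread V hr hr1
  set b := volume.real (ball (0 : V) 1) with hb
  have hb0 : 0 < b := measureReal_ball_pos _ one_pos
  refine ⟨C₂.toReal * (1 + C₁) + 2 * b / ε₀, by positivity, fun h φ ε hm h1 hφ hφ1 hε hd => ?_⟩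
  rcases le_or_gt ε ε₀ with hle | hgt
  · obtain ⟨ℓ, γ, hγ, hℓ⟩ := H h φ ε hm h1 hφ hφ1 hε.le hle hd
    have hℓc : Continuous ℓ := ℓ.continuous_of_finiteDimensional
    have hEm : Measurable fun z : V => Complex.exp (Complex.I * (ℓ z : ℂ)) :=
      (Complex.continuous_exp.comp (continuous_const.mul
        (Complex.continuous_ofReal.comp hℓc))).measurable
    set E : V → ℂ := fun z => Complex.exp (Complex.I * (ℓ z : ℂ)) with hE
    have hEadd : ∀ x y, E (x + y) = E x * E y := fun x y => by
      simp only [hE, map_add, Complex.ofReal_add, mul_add, Complex.exp_add]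
    have hE1 : ∀ x, ‖E x‖ = 1 := fun x => by
      simp only [hE]; rw [mul_comm, Complex.norm_exp_ofReal_mul_I]
    have hE0 : ∀ x, E x ≠ 0 := fun x => Complex.exp_ne_zero _
    have hγ0 : γ ≠ 0 := norm_ne_zero_iff.1 (by rw [hγ]; exact one_ne_zero)
    -- Dividing `h` by the local phase and `φ` by its character leaves the defect unchanged and
    -- reduces spreading to functions near `1`.
    set h' : V → ℂ := fun x => h x / (E x * γ) with hh'
    set φ' : V → ℂ := fun t => φ t / E t with hφ'
    have hdiff : ∀ x, ‖h' x - 1‖ₑ = ‖h x - E x * γ‖ₑ := fun x => by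
      have h2 : E x * γ ≠ 0 := mul_ne_zero (hE0 x) hγ0
      rw [← ofReal_norm, ← ofReal_norm, hh', div_sub_one h2, norm_div, norm_mul, hE1, hγ, mul_one,
        div_one]
    have hd' : ∀ t, transDefect h' φ' t = transDefect h φ t := fun t => by
      unfold transDefect
      congr with s
      have h2 : h' (s + t) - φ' t * h' s = (h (s + t) - φ t * h s) / (E s * E t * γ) := by
        simp only [hh', hφ', hEadd]
        have := hE0 s; have := hE0 t
        field_simp
      rw [← ofReal_norm, ← ofReal_norm, h2, norm_div, norm_mul, norm_mul, hE1, hE1, hγ]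
      simp
    have hle2 : ENNReal.ofReal ε ≤ ENNReal.ofReal ((1 + C₁) * ε) :=
      ENNReal.ofReal_le_ofReal (by nlinarith)
    have hle3 : ENNReal.ofReal (C₁ * ε) ≤ ENNReal.ofReal ((1 + C₁) * ε) :=
      ENNReal.ofReal_le_ofReal (by nlinarith)
    have hfin := H₂ h' φ' (ENNReal.ofReal ((1 + C₁) * ε)) (hm.div (hEm.mul_const _))
      (fun x => by rw [hh', norm_div, norm_mul, hE1, h1, hγ]; simp) (hφ.div hEm)
      (fun t => by rw [hφ', norm_div, hE1, div_one]; exact hφ1 t)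
      (by simp only [hd']; exact hd.trans hle2) (by simp only [hdiff]; exact hℓ.trans hle3)
    refine ⟨ℓ.toAffineMap + AffineMap.const ℝ V (Complex.arg γ), ?_⟩
    have e : ∀ x, Complex.exp (Complex.I *
        (((ℓ.toAffineMap + AffineMap.const ℝ V (Complex.arg γ)) x : ℝ) : ℂ)) = E x * γ := by
      intro x
      have h2 := Complex.norm_mul_exp_arg_mul_I γ
      rw [hγ, Complex.ofReal_one, one_mul] at h2
      simp only [AffineMap.coe_add, Pi.add_apply, LinearMap.coe_toAffineMap, AffineMap.const_apply]
      rw [Complex.ofReal_add, mul_add, Complex.exp_add, mul_comm Complex.I (Complex.arg γ : ℂ), h2]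
    calc _ = ∫⁻ x in ball (0 : V) 1, ‖h' x - 1‖ₑ := by
          congr with x
          rw [e, hdiff, ← enorm_neg, neg_sub]
      _ ≤ _ := hfin
      _ = ENNReal.ofReal (C₂.toReal * ((1 + C₁) * ε)) := by
          rw [ENNReal.ofReal_mul ENNReal.toReal_nonneg, ENNReal.ofReal_toReal hC₂]
      _ ≤ _ := by
          refine ENNReal.ofReal_le_ofReal ?_
          have : 0 ≤ 2 * b / ε₀ * ε := by positivity
          nlinarith
  -- For `ε > ε₀` the trivial bound `2 * b` suffices; the term `2 * b / ε₀` of the constant absorbs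
  -- it.
  · refine ⟨0, ?_⟩
    calc ∫⁻ x in ball (0 : V) 1, ‖Complex.exp (Complex.I * (((0 : V →ᵃ[ℝ] ℝ) x : ℝ) : ℂ)) - h x‖ₑ
        ≤ ∫⁻ x in ball (0 : V) 1, ENNReal.ofReal 2 := by
          refine lintegral_mono fun x => ?_
          rw [← ofReal_norm]
          refine ENNReal.ofReal_le_ofReal ((norm_sub_le _ _).trans ?_)
          rw [h1]
          simp
          norm_num
      _ = ENNReal.ofReal (2 * b) := by
          rw [setLIntegral_const, ENNReal.ofReal_mul (by norm_num), hb, ofReal_measureReal_ball]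
      _ ≤ _ := by
          refine ENNReal.ofReal_le_ofReal ?_
          have h2 : 2 * b ≤ 2 * b / ε₀ * ε := by
            rw [div_mul_eq_mul_div, le_div_iff₀ hε₀]
            gcongr
          have : 0 ≤ C₂.toReal * (1 + C₁) * ε := by positivity
          linarith

end Spreading

/-! ### Large exponents, and the combination of both regimes -/

section LargeExponent

open Filter Topology Metric ComplexConjugate

variable {V : Type*} [NormedAddCommGroup V] [InnerProductSpace ℝ V] [MeasurableSpace V]
  [BorelSpace V] [FiniteDimensional ℝ V]

set_option linter.unusedSectionVars false

theorem fourier_ballInd (ξ : V) :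
    𝓕 (ballInd V 1) ξ = ∫ v in ball (0 : V) 1, (Real.fourierChar (-inner ℝ v ξ) : ℂ) := by
  rw [Real.fourier_eq, ← integral_indicator measurableSet_ball]
  congr with v
  rw [ballInd, Circle.smul_def, smul_eq_mul]
  by_cases hv : v ∈ ball (0 : V) 1
  · rw [Set.indicator_of_mem hv, Set.indicator_of_mem hv]; simp
  · rw [Set.indicator_of_notMem hv, Set.indicator_of_notMem hv]; simp

theorem le_norm_fourier_ballInd (ξ : V) :
    volume.real (ball (0 : V) 1) * (1 - 2 * Real.pi * ‖ξ‖) ≤ ‖𝓕 (ballInd V 1) ξ‖ := by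
  set b := volume.real (ball (0 : V) 1) with hb
  have hcont : Continuous fun v : V => (Real.fourierChar (-inner ℝ v ξ) : ℂ) :=
    continuous_subtype_val.comp (Real.continuous_fourierChar.comp (by fun_prop))
  have hi : IntegrableOn (fun v : V => (Real.fourierChar (-inner ℝ v ξ) : ℂ)) (ball (0 : V) 1) :=
    Measure.integrableOn_of_bounded (M := 1) measure_ball_lt_top.ne hcont.aestronglyMeasurable
      (Eventually.of_forall fun v => (Circle.norm_coe _).le)
  have h1 : IntegrableOn (fun _ : V => (1 : ℂ)) (ball (0 : V) 1) :=
    integrableOn_const measure_ball_lt_top.ne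
  have hdiff : ‖∫ v in ball (0 : V) 1, ((1 : ℂ) - (Real.fourierChar (-inner ℝ v ξ) : ℂ))‖ ≤
      2 * Real.pi * ‖ξ‖ * b := by
    refine norm_setIntegral_le_of_norm_le_const measure_ball_lt_top fun v hv => ?_
    rw [norm_sub_rev, Real.fourierChar_apply, mul_comm _ Complex.I]
    refine Real.norm_exp_I_mul_ofReal_sub_one_le.trans ?_
    rw [norm_mul, norm_neg, Real.norm_of_nonneg (by positivity)]
    gcongr
    refine (norm_inner_le_norm _ _).trans ?_
    rw [mem_ball_zero_iff] at hv
    exact mul_le_of_le_one_left (norm_nonneg _) hv.le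
  rw [integral_sub h1 hi, ← fourier_ballInd] at hdiff
  have h2 : ‖∫ _ in ball (0 : V) 1, (1 : ℂ)‖ = b := by simp [hb]
  have h3 := norm_sub_norm_le (∫ _ in ball (0 : V) 1, (1 : ℂ)) (𝓕 (ballInd V 1) ξ)
  rw [h2] at h3
  linarith

/-- On the ball of radius `1 / (4πq)`, `q = 2k`, the transform is at least `|B| (1 - 1/(2q))`, and
Bernoulli's inequality keeps the `q`-th power above half of `|B|^q`. Only a factor polynomial in `q`
is lost. -/
theorem le_integral_norm_fourier_ballInd_pow {k : ℕ} (hk : 1 ≤ k) :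
    volume.real (ball (0 : V) 1) ^ (2 * k) / 2 *
        ((1 / (4 * Real.pi * (2 * k : ℕ))) ^ Module.finrank ℝ V * volume.real (ball (0 : V) 1)) ≤
      ∫ ξ : V, ‖𝓕 (ballInd V 1) ξ‖ ^ (2 * k) := by
  set b := volume.real (ball (0 : V) 1) with hb
  have hb0 : 0 ≤ b := measureReal_nonneg
  have hq : (0 : ℝ) < (2 * k : ℕ) := by exact_mod_cast (by omega : 0 < 2 * k)
  set q : ℝ := ((2 * k : ℕ) : ℝ) with hqdef
  set r : ℝ := 1 / (4 * Real.pi * q) with hr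
  have hr0 : 0 < r := by positivity
  have hi : Integrable fun ξ : V => ‖𝓕 (ballInd V 1) ξ‖ ^ (2 * k) := by
    have := integrable_norm_fourier_pow (integrable_ballInd (V := V) 1) (norm_ballInd_le 1) (k - 1)
    rwa [show k - 1 + 1 = k by omega] at this
  have hvol : volume.real (ball (0 : V) r) = r ^ Module.finrank ℝ V * b := by
    rw [Measure.real, Measure.addHaar_ball_of_pos volume _ hr0, ENNReal.toReal_mul,
      ENNReal.toReal_ofReal (by positivity)]
    rfl
  have hpt : ∀ ξ ∈ ball (0 : V) r, b ^ (2 * k) / 2 ≤ ‖𝓕 (ballInd V 1) ξ‖ ^ (2 * k) := by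
    intro ξ hξ
    rw [mem_ball_zero_iff] at hξ
    have h2 : 2 * Real.pi * ‖ξ‖ ≤ 1 / (2 * q) := by
      calc 2 * Real.pi * ‖ξ‖ ≤ 2 * Real.pi * r := by gcongr
        _ = 1 / (2 * q) := by rw [hr]; field_simp; norm_num
    have hq1 : 1 / (2 * q) ≤ 1 := by
      rw [div_le_one (by positivity)]
      have : (1 : ℝ) ≤ q := by rw [hqdef]; exact_mod_cast (by omega : 1 ≤ 2 * k)
      linarith
    have h3 : b * (1 - 1 / (2 * q)) ≤ ‖𝓕 (ballInd V 1) ξ‖ :=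
      le_trans (by gcongr) (le_norm_fourier_ballInd ξ)
    have h4 : 1 / 2 ≤ (1 - 1 / (2 * q)) ^ (2 * k) := by
      have := one_add_mul_le_pow (a := -(1 / (2 * q))) (by linarith) (2 * k)
      rw [← sub_eq_add_neg] at this
      refine le_trans (le_of_eq ?_) this
      rw [← hqdef]; field_simp; norm_num
    calc b ^ (2 * k) / 2 = b ^ (2 * k) * (1 / 2) := by ring
      _ ≤ b ^ (2 * k) * (1 - 1 / (2 * q)) ^ (2 * k) := by gcongr
      _ = (b * (1 - 1 / (2 * q))) ^ (2 * k) := (mul_pow _ _ _).symm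
      _ ≤ _ := by
        gcongr
  calc _ = ∫ ξ in ball (0 : V) r, b ^ (2 * k) / 2 := by
        rw [setIntegral_const, hvol, smul_eq_mul]; ring
    _ ≤ ∫ ξ in ball (0 : V) r, ‖𝓕 (ballInd V 1) ξ‖ ^ (2 * k) :=
        setIntegral_mono_on (integrableOn_const measure_ball_lt_top.ne) hi.integrableOn
          measurableSet_ball hpt
    _ ≤ _ := setIntegral_le_integral hi (Eventually.of_forall fun ξ => by positivity)

theorem integral_norm_sq_ball_indicator {h : V → ℂ} (h1 : ∀ x, ‖h x‖ = 1) (r : ℝ) :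
    ∫ x, ‖(ball (0 : V) r).indicator h x‖ ^ 2 = volume.real (ball (0 : V) r) := by
  rw [← integral_indicator_one measurableSet_ball]
  congr with x
  by_cases hx : x ∈ ball (0 : V) r
  · rw [Set.indicator_of_mem hx, Set.indicator_of_mem hx, h1, one_pow]; rfl
  · rw [Set.indicator_of_notMem hx, Set.indicator_of_notMem hx]; simp

/-- All but two of the powers are bounded by the supremum, and Plancherel handles the remaining
square. -/
theorem integral_norm_fourier_pow_le {h : V → ℂ} (hm : Measurable h) (h1 : ∀ x, ‖h x‖ = 1)
    {S : ℝ} (hS : ∀ ξ, ‖𝓕 ((ball (0 : V) 1).indicator h) ξ‖ ≤ S) {k : ℕ} (hk : 1 ≤ k) :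
    ∫ ξ, ‖𝓕 ((ball (0 : V) 1).indicator h) ξ‖ ^ (2 * k) ≤
      S ^ (2 * k - 2) * volume.real (ball (0 : V) 1) := by
  set f := (ball (0 : V) 1).indicator h with hf
  have hfi : Integrable f := integrable_ball_indicator hm h1 1
  have hf1 : ∀ x, ‖f x‖ ≤ 1 := fun x => (norm_indicator_le h1 _ x).trans (indicator_one_le_one _ x)
  have i1 := integrable_norm_fourier_pow hfi hf1 0
  have i2 := integrable_norm_fourier_pow hfi hf1 (k - 1)
  rw [show k - 1 + 1 = k by omega] at i2
  simp only [zero_add, mul_one] at i1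
  rw [← integral_norm_sq_ball_indicator h1 1, ← hf, ← integral_norm_fourier_sq hfi hf1,
    ← integral_const_mul]
  refine integral_mono i2 (i1.const_mul _) fun ξ => ?_
  dsimp only
  rw [show 2 * k = (2 * k - 2) + 2 by omega, pow_add, show 2 * k - 2 + 2 - 2 = 2 * k - 2 by omega]
  gcongr
  exact hS ξ

variable (V) in
-- If all coefficients were smaller, then `(1 - δ)^q c₁ q^{-D} ≤ (1 - τ)^{q-2}`. In logarithms the
-- left side loses `O(qδ + log q)`, the right side at least `qτ / 2`; for `q ≥ δ^{-1/2}` the choice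
-- `τ = C δ^{1/4}` outweighs the loss.
theorem exists_le_norm_fourier_of_large_exponent :
    ∃ C : ℝ, 0 < C ∧ ∀ (k : ℕ) (δ : ℝ) (h : V → ℂ), 2 ≤ k → 0 < δ → δ ≤ 1 / 2 →
      δ ^ (-(1 / 2) : ℝ) ≤ (2 * k : ℕ) → Measurable h → (∀ x, ‖h x‖ = 1) →
      (1 - δ) ^ (2 * k) * ∫ ξ, ‖𝓕 (ballInd V 1) ξ‖ ^ (2 * k) ≤
        ∫ ξ, ‖𝓕 ((ball (0 : V) 1).indicator h) ξ‖ ^ (2 * k) →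
      ∃ ξ, volume.real (ball (0 : V) 1) * (1 - C * δ ^ (1 / 4 : ℝ)) ≤
        ‖𝓕 ((ball (0 : V) 1).indicator h) ξ‖ := by
  set b := volume.real (ball (0 : V) 1) with hb
  have hb0 : 0 < b := measureReal_ball_pos _ one_pos
  set D := Module.finrank ℝ V with hD
  set c₁ := b ^ 2 / 2 * (1 / (4 * Real.pi)) ^ D with hc₁
  have hc₁0 : 0 < c₁ := by positivity
  refine ⟨9 + 8 * D + 4 * |Real.log c₁|, by positivity,
    fun k δ h hk hδ hδ2 hq hm h1 hle => ?_⟩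
  set C := 9 + 8 * (D : ℝ) + 4 * |Real.log c₁| with hC
  set τ := C * δ ^ (1 / 4 : ℝ) with hτ
  have hτ0 : 0 < τ := by positivity
  by_contra! hlt
  have hτ1 : 0 < 1 - τ := by
    have := (norm_nonneg _).trans_lt (hlt 0)
    exact (pos_iff_pos_of_mul_pos this).1 hb0
  have hup := integral_norm_fourier_pow_le hm h1 (fun ξ => (hlt ξ).le) (k := k) (by omega)
  have hlow := le_integral_norm_fourier_ballInd_pow (V := V) (k := k) (by omega)
  rw [← hb, ← hD] at hlow
  rw [← hb] at hup
  set q : ℝ := ((2 * k : ℕ) : ℝ) with hqdef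
  have hq4 : 4 ≤ q := by rw [hqdef]; exact_mod_cast (by omega : 4 ≤ 2 * k)
  have hq0 : 0 < q := by linarith
  have hmain : (1 - δ) ^ (2 * k) * (c₁ * (1 / q) ^ D) ≤ (1 - τ) ^ (2 * k - 2) := by
    have h2 : (1 - δ) ^ (2 * k) * (b ^ (2 * k) / 2 * ((1 / (4 * Real.pi * q)) ^ D * b)) ≤
        (b * (1 - τ)) ^ (2 * k - 2) * b :=
      (mul_le_mul_of_nonneg_left hlow (pow_nonneg (by linarith) _)).trans (hle.trans hup)
    have h3 : (1 - δ) ^ (2 * k) * (b ^ (2 * k) / 2 * ((1 / (4 * Real.pi * q)) ^ D * b)) =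
        (b ^ (2 * k - 2) * b) * ((1 - δ) ^ (2 * k) * (c₁ * (1 / q) ^ D)) := by
      have e1 : b ^ (2 * k) = b ^ (2 * k - 2) * b ^ 2 := by
        rw [← pow_add]; congr 1; omega
      have e2 : (1 / (4 * Real.pi * q)) ^ D = (1 / (4 * Real.pi)) ^ D * (1 / q) ^ D := by
        rw [← mul_pow]; congr 1; field_simp
      rw [e1, e2, hc₁]; ring
    have h4 : (b * (1 - τ)) ^ (2 * k - 2) * b = (b ^ (2 * k - 2) * b) * (1 - τ) ^ (2 * k - 2) := by
      rw [mul_pow]; ring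
    rw [h3, h4] at h2
    exact le_of_mul_le_mul_left h2 (by positivity)
  have hlog := Real.log_le_log (by
    have : 0 < 1 - δ := by linarith
    positivity) hmain
  rw [Real.log_mul (pow_ne_zero _ (by linarith)) (by positivity), Real.log_mul hc₁0.ne'
    (by positivity), Real.log_pow, Real.log_pow, Real.log_pow, ← hqdef, one_div, Real.log_inv] at hlog
  have hcast : ((2 * k - 2 : ℕ) : ℝ) = q - 2 := by
    rw [hqdef, Nat.cast_sub (by omega)]; norm_num
  rw [hcast] at hlog
  have l1 : Real.log (1 - τ) ≤ -τ := by linarith [Real.log_le_sub_one_of_pos hτ1]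
  have l2 : -(2 * δ) ≤ Real.log (1 - δ) := by
    have h5 := Real.one_sub_inv_le_log_of_pos (show 0 < 1 - δ by linarith)
    refine le_trans ?_ h5
    have h6 : (1 - δ)⁻¹ ≤ 1 + 2 * δ := by
      rw [inv_le_iff_one_le_mul₀ (by linarith)]
      nlinarith
    linarith
  have hsq0 : 0 < √q := Real.sqrt_pos.2 hq0
  have hsq : √q * √q = q := Real.mul_self_sqrt hq0.le
  have hsq1 : 1 ≤ √q := Real.one_le_sqrt.2 (by linarith)
  have l3 : Real.log q ≤ 2 * √q := by
    rw [← hsq, Real.log_mul hsq0.ne' hsq0.ne', hsq]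
    linarith [Real.log_le_sub_one_of_pos hsq0]
  have l4 : δ ≤ δ ^ (1 / 4 : ℝ) := by
    have := Real.rpow_le_rpow_of_exponent_ge hδ (by linarith) (show (1 / 4 : ℝ) ≤ 1 by norm_num)
    rwa [Real.rpow_one] at this
  -- The only use of the size of `q`: it turns `log q ≤ 2√q` and the constant terms into multiples
  -- of `q * δ^{1/4}`.
  have l5 : 1 ≤ δ ^ (1 / 4 : ℝ) * √q := by
    have h7 : δ ^ (-(1 / 4) : ℝ) ≤ √q := by
      rw [Real.le_sqrt (by positivity) hq0.le, ← Real.rpow_natCast, ← Real.rpow_mul hδ.le]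
      norm_num at hq ⊢
      exact hq
    calc (1 : ℝ) = δ ^ (1 / 4 : ℝ) * δ ^ (-(1 / 4) : ℝ) := by
          rw [← Real.rpow_add hδ]; norm_num
      _ ≤ _ := by gcongr
  have l6 : -|Real.log c₁| ≤ Real.log c₁ := neg_abs_le _
  set y := δ ^ (1 / 4 : ℝ) with hy
  have hy0 : 0 < y := by positivity
  have m1 : (q - 2) * Real.log (1 - τ) ≤ -(q / 2 * τ) := by
    have n1 := mul_le_mul_of_nonneg_left l1 (show 0 ≤ q - 2 by linarith)
    have n2 := mul_le_mul_of_nonneg_right (show q / 2 ≤ q - 2 by linarith) hτ0.le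
    linarith
  have m2 : -(q * (2 * y)) ≤ q * Real.log (1 - δ) := by
    have n1 := mul_le_mul_of_nonneg_left (show -(2 * y) ≤ Real.log (1 - δ) by linarith) hq0.le
    linarith
  have m3 : (D : ℝ) * Real.log q ≤ D * (2 * √q) := by gcongr
  have m4 : |Real.log c₁| ≤ |Real.log c₁| * √q := le_mul_of_one_le_right (abs_nonneg _) hsq1
  have m5 : √q ≤ q * y := by
    calc √q = 1 * √q := (one_mul _).symm
      _ ≤ (y * √q) * √q := by gcongr
      _ = q * y := by rw [mul_assoc, hsq, mul_comm]
  have m6 : (2 * (D : ℝ) + |Real.log c₁|) * √q ≤ (2 * D + |Real.log c₁|) * (q * y) := by gcongr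
  have m7 : q / 2 * τ = (9 / 2 + 4 * D + 2 * |Real.log c₁|) * (q * y) := by
    rw [hτ, hC]; ring
  have hqy : 0 < q * y := by positivity
  have m8 : 0 ≤ (2 * (D : ℝ) + |Real.log c₁|) * (q * y) := by positivity
  have hl' : q * Real.log (1 - δ) + (Real.log c₁ + D * -Real.log q) ≤
      (q - 2) * Real.log (1 - τ) := hlog
  linarith

/-- A large Fourier coefficient makes a unimodular function close to an affine phase. -/
theorem exists_affine_phase_of_le_norm_fourier {h : V → ℂ} (hm : Measurable h)
    (h1 : ∀ x, ‖h x‖ = 1) {τ : ℝ} (hτ : 0 < τ) {ξ : V}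
    (hξ : volume.real (ball (0 : V) 1) * (1 - τ) ≤ ‖𝓕 ((ball (0 : V) 1).indicator h) ξ‖) :
    ∃ L : V →ᵃ[ℝ] ℝ, ∫⁻ x in ball (0 : V) 1, ‖Complex.exp (Complex.I * (L x : ℂ)) - h x‖ₑ ≤
      ENNReal.ofReal (2 * volume.real (ball (0 : V) 1) * √τ) := by
  set b := volume.real (ball (0 : V) 1) with hb
  set F := 𝓕 ((ball (0 : V) 1).indicator h) ξ with hF
  -- The frequency of the large coefficient gives the slope and its argument the constant term, so
  -- that `h` correlates with `e^{iL}` to exactly `‖F‖`.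
  set L : V →ᵃ[ℝ] ℝ := ((2 * Real.pi) • (innerₗ V ξ)).toAffineMap +
    AffineMap.const ℝ V (Complex.arg F) with hL
  have hLx : ∀ x, L x = 2 * Real.pi * inner ℝ ξ x + Complex.arg F := fun x => by
    simp [hL]
  have hLc : Continuous fun x => L x := by
    simp only [hLx]; fun_prop
  set E : V → ℂ := fun x => Complex.exp (Complex.I * (L x : ℂ)) with hE
  have hEc : Continuous E := by
    simp only [hE]; fun_prop
  have hE1 : ∀ x, ‖E x‖ = 1 := fun x => by
    simp only [hE]; rw [mul_comm, Complex.norm_exp_ofReal_mul_I]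
  have hFint : F = ∫ v in ball (0 : V) 1, (Real.fourierChar (-inner ℝ v ξ) : ℂ) * h v := by
    rw [hF, Real.fourier_eq, ← integral_indicator measurableSet_ball]
    congr with u
    rw [Set.indicator_mul_right, Circle.smul_def, smul_eq_mul]
  have hconj : ∀ v, h v * conj (E v) =
      Complex.exp (-(Complex.arg F * Complex.I)) *
        ((Real.fourierChar (-inner ℝ v ξ) : ℂ) * h v) := by
    intro v
    rw [hE, ← Complex.exp_conj, Real.fourierChar_apply, ← mul_assoc, ← Complex.exp_add, mul_comm]
    congr 2
    rw [map_mul, Complex.conj_I, Complex.conj_ofReal, hLx, real_inner_comm]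
    push_cast
    ring
  have hgm : Measurable fun v => h v * conj (E v) := by
    have := hEc.measurable
    fun_prop
  have hgi : IntegrableOn (fun v => h v * conj (E v)) (ball (0 : V) 1) :=
    Measure.integrableOn_of_bounded (M := 1) measure_ball_lt_top.ne hgm.aestronglyMeasurable
      (Eventually.of_forall fun v => by simp [h1, hE1])
  have hint : ∫ v in ball (0 : V) 1, h v * conj (E v) = (‖F‖ : ℂ) := by
    simp only [hconj]
    rw [integral_const_mul, ← hFint]
    nth_rewrite 2 [← Complex.norm_mul_exp_arg_mul_I F]
    rw [mul_left_comm, ← Complex.exp_add, neg_add_cancel, Complex.exp_zero, mul_one]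
  have hdi : IntegrableOn (fun x => E x - h x) (ball (0 : V) 1) := by
    refine Measure.integrableOn_of_bounded (M := 2) measure_ball_lt_top.ne
      (hEc.measurable.sub hm).aestronglyMeasurable (Eventually.of_forall fun v => ?_)
    refine (norm_sub_le _ _).trans ?_
    rw [h1, hE1]; norm_num
  have h1i : IntegrableOn (fun _ : V => (1 : ℝ)) (ball (0 : V) 1) :=
    integrableOn_const measure_ball_lt_top.ne
  have hre : IntegrableOn (fun v => (h v * conj (E v)).re) (ball (0 : V) 1) := hgi.re
  have hsi : IntegrableOn (fun v => 1 - (h v * conj (E v)).re) (ball (0 : V) 1) := h1i.sub hre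
  have hs : 0 < √τ := Real.sqrt_pos.2 hτ
  refine ⟨L, ?_⟩
  rw [← ofReal_integral_norm_eq_lintegral_enorm hdi]
  refine ENNReal.ofReal_le_ofReal ?_
  calc ∫ x in ball (0 : V) 1, ‖E x - h x‖
      ≤ ∫ x in ball (0 : V) 1, (√τ / 2 * 1 + (√τ)⁻¹ * (1 - (h x * conj (E x)).re)) := by
        refine integral_mono hdi.norm ((h1i.const_mul _).add (hsi.const_mul _)) fun x => ?_
        have h2 := norm_sub_sq_le_of_norm_le_one (u := 1) (hE1 x) (h1 x) (by simp)
        rw [one_mul, one_mul] at h2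
        set y := ‖E x - h x‖
        have h3 : y ≤ √τ / 2 * 1 + (√τ)⁻¹ * (y ^ 2 / 2) := by
          rw [← sub_nonneg]
          have : √τ / 2 * 1 + (√τ)⁻¹ * (y ^ 2 / 2) - y = (√τ)⁻¹ * ((y - √τ) ^ 2 / 2) := by
            field_simp; ring
          rw [this]; positivity
        refine h3.trans ?_
        gcongr
        linarith
    _ = √τ * b / 2 + (√τ)⁻¹ * (b - ‖F‖) := by
        rw [integral_add (h1i.const_mul (√τ / 2)) (hsi.const_mul _), integral_const_mul,
          integral_const_mul, integral_sub h1i hre]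
        have h4 := integral_re hgi
        simp only [RCLike.re_to_complex] at h4
        rw [h4, hint, Complex.ofReal_re]
        simp [hb]
        ring
    _ ≤ √τ * b / 2 + (√τ)⁻¹ * (b * τ) := by
        gcongr
        linarith
    _ = 3 / 2 * b * √τ := by
        have : (√τ)⁻¹ * (b * τ) = b * √τ := by
          nth_rewrite 2 [← Real.mul_self_sqrt hτ.le]
          field_simp
        rw [this]; ring
    _ ≤ _ := by
        have : 0 ≤ b := measureReal_nonneg
        gcongr
        norm_num

variable (V) in
/-- **Stability of the Hausdorff–Young ratio on the ball at even exponents**, with constants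
uniform in the exponent. -/
theorem exists_affine_phase_of_integral_norm_fourier :
    ∃ C : ℝ, 0 < C ∧ ∀ (k : ℕ) (δ : ℝ) (h : V → ℂ), 2 ≤ k → 0 < δ → δ ≤ 1 / 2 → Measurable h →
      (∀ x, ‖h x‖ = 1) →
      (1 - δ) ^ (2 * k) * ∫ ξ, ‖𝓕 (ballInd V 1) ξ‖ ^ (2 * k) ≤
        ∫ ξ, ‖𝓕 ((ball (0 : V) 1).indicator h) ξ‖ ^ (2 * k) →
      ∃ L : V →ᵃ[ℝ] ℝ, ∫⁻ x in ball (0 : V) 1, ‖Complex.exp (Complex.I * (L x : ℂ)) - h x‖ₑ ≤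
        ENNReal.ofReal (C * δ ^ (1 / 8 : ℝ)) := by
  obtain ⟨C₁, hC₁, H₁⟩ := exists_le_norm_fourier_of_large_exponent V
  obtain ⟨C₂, hC₂, H₂⟩ := exists_lintegral_transDefect_le V
  obtain ⟨C₃, hC₃, H₃⟩ := exists_affine_phase_of_transDefect V
  set b := volume.real (ball (0 : V) 1) with hb
  have hb0 : 0 < b := measureReal_ball_pos _ one_pos
  refine ⟨2 * b * √C₁ + C₃ * C₂, by positivity, fun k δ h hk hδ hδ2 hm h1 hle => ?_⟩
  have hpow : 0 < δ ^ (1 / 8 : ℝ) := by positivity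
  -- Above the threshold a Fourier deficit of order `δ^{1/4}` gives an error of order its root
  -- `δ^{1/8}`. Below it `q * δ ≤ δ^{1/2}`, and the convolution argument gives `√(q * δ) ≤ δ^{1/4}`.
  rcases le_or_gt (δ ^ (-(1 / 2) : ℝ)) ((2 * k : ℕ) : ℝ) with hq | hq
  · obtain ⟨ξ, hξ⟩ := H₁ k δ h hk hδ hδ2 hq hm h1 hle
    obtain ⟨L, hL⟩ := exists_affine_phase_of_le_norm_fourier hm h1
      (τ := C₁ * δ ^ (1 / 4 : ℝ)) (by positivity) hξ
    refine ⟨L, hL.trans (ENNReal.ofReal_le_ofReal ?_)⟩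
    have e : √(C₁ * δ ^ (1 / 4 : ℝ)) = √C₁ * δ ^ (1 / 8 : ℝ) := by
      rw [Real.sqrt_mul hC₁.le, Real.sqrt_eq_rpow (δ ^ (1 / 4 : ℝ)), ← Real.rpow_mul hδ.le]
      norm_num
    rw [e, ← hb]
    have : 0 ≤ C₃ * C₂ * δ ^ (1 / 8 : ℝ) := by positivity
    linarith
  · set q : ℝ := ((2 * k : ℕ) : ℝ) with hqdef
    have hq0 : 0 < q := by rw [hqdef]; exact_mod_cast (by omega : 0 < 2 * k)
    have hη : 0 < q * δ := by positivity
    have hbern : 1 - q * δ ≤ (1 - δ) ^ (2 * k) := by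
      have := one_add_mul_le_pow (a := -δ) (by linarith) (2 * k)
      rw [← sub_eq_add_neg, ← hqdef] at this
      linarith
    -- The index `n` there corresponds to the exponent `2 * (n + 2)`, which is where `q ≥ 4` is
    -- needed.
    obtain ⟨φ, hφ, hφ1, hd⟩ := H₂ (k - 2) (q * δ) h hη hm h1 (by
      rw [show k - 2 + 2 = k by omega]
      refine le_trans ?_ hle
      gcongr)
    have hroot : √(q * δ) ≤ δ ^ (1 / 8 : ℝ) := by
      have h2 : q * δ ≤ δ ^ (1 / 2 : ℝ) := by
        calc q * δ ≤ δ ^ (-(1 / 2) : ℝ) * δ := by gcongr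
          _ = δ ^ (1 / 2 : ℝ) := by
            nth_rewrite 2 [← Real.rpow_one δ]
            rw [← Real.rpow_add hδ]; norm_num
      calc √(q * δ) ≤ √(δ ^ (1 / 2 : ℝ)) := Real.sqrt_le_sqrt h2
        _ = δ ^ (1 / 4 : ℝ) := by
          rw [Real.sqrt_eq_rpow, ← Real.rpow_mul hδ.le]; norm_num
        _ ≤ _ := Real.rpow_le_rpow_of_exponent_ge hδ (by linarith) (by norm_num)
    obtain ⟨L, hL⟩ := H₃ h φ (C₂ * √(q * δ)) hm h1 hφ hφ1
      (mul_pos hC₂ (Real.sqrt_pos.2 hη)) hd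
    refine ⟨L, hL.trans (ENNReal.ofReal_le_ofReal ?_)⟩
    calc C₃ * (C₂ * √(q * δ)) ≤ C₃ * (C₂ * δ ^ (1 / 8 : ℝ)) := by gcongr
      _ ≤ _ := by
        have : 0 ≤ 2 * b * √C₁ * δ ^ (1 / 8 : ℝ) := by positivity
        linarith

end LargeExponent

/-! ### Passage to the extremal constant and the proposition -/

section HausdorffYoung

open Metric

variable {V : Type*} [NormedAddCommGroup V] [InnerProductSpace ℝ V] [MeasurableSpace V]
  [BorelSpace V] [FiniteDimensional ℝ V]

/-- The ball and its indicator are admissible in the supremum. Nothing more about the extremal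
constant is needed: a function nearly attaining it nearly matches or exceeds the indicator of the
ball. -/
theorem eLpNorm_fourier_le_hyConst_mul {d : ℕ} {q p : ℝ} (hpq : q.HolderConjugate p) :
    eLpNorm (𝓕 (ballInd (EuclideanSpace ℝ (Fin d)) 1)) (ENNReal.ofReal q) volume ≤
      hyConst d q * volume (ball (0 : EuclideanSpace ℝ (Fin d)) 1) ^ (1 / p) := by
  set B := ball (0 : EuclideanSpace ℝ (Fin d)) 1 with hB
  have h0 : 0 < volume B := measure_ball_pos _ _ one_pos
  have ht : volume B < ⊤ := measure_ball_lt_top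
  have hp : 0 < p := hpq.symm.pos
  have hnorm : eLpNorm (B.indicator fun _ => (1 : ℝ)) (ENNReal.ofReal (Real.conjExponent q)) volume =
      volume B ^ (1 / p) := by
    rw [Real.conjExponent, ← hpq.conjugate_eq, eLpNorm_indicator_const measurableSet_ball
      (ENNReal.ofReal_pos.2 hp).ne' ENNReal.ofReal_ne_top, ENNReal.toReal_ofReal hp.le]
    simp [hB]
  have hratio : eLpNorm (𝓕 (ballInd (EuclideanSpace ℝ (Fin d)) 1)) (ENNReal.ofReal q) volume /
      eLpNorm (B.indicator fun _ => (1 : ℝ)) (ENNReal.ofReal (Real.conjExponent q)) volume ≤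
      hyConst d q := by
    refine le_trans ?_ (le_iSup_of_le B <| le_iSup_of_le measurableSet_ball.nullMeasurableSet <|
      le_iSup_of_le h0 <| le_iSup_of_le ht le_rfl)
    refine le_iSup_of_le (ballInd _ 1) <| le_iSup_of_le (integrable_ballInd 1).1 <|
      le_iSup_of_le (fun x => ?_) le_rfl
    rw [ballInd, Complex.norm_real, Real.norm_of_nonneg (indicator_one_nonneg 1 x)]
    rfl
  rw [hnorm] at hratio
  exact (ENNReal.div_le_iff (ENNReal.rpow_pos h0 ht.ne).ne'
    (ENNReal.rpow_ne_top_of_nonneg (by positivity) ht.ne)).1 hratio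

theorem eLpNorm_pow_eq_ofReal_integral {α : Type*} [MeasurableSpace α] {μ : Measure α} {F : α → ℂ}
    {n : ℕ} (hn : n ≠ 0) (hF : Integrable (fun x => ‖F x‖ ^ n) μ) :
    eLpNorm F (n : ℝ≥0∞) μ ^ n = ENNReal.ofReal (∫ x, ‖F x‖ ^ n ∂μ) := by
  have h := eLpNorm_eq_lintegral_rpow_enorm_toReal (f := F) (μ := μ) (p := (n : ℝ≥0∞))
    (by exact_mod_cast hn) (ENNReal.natCast_ne_top n)
  have hn0 : (n : ℝ) ≠ 0 := by exact_mod_cast hn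
  rw [h, ENNReal.toReal_natCast, ← ENNReal.rpow_natCast, ← ENNReal.rpow_mul, one_div,
    inv_mul_cancel₀ hn0, ENNReal.rpow_one,
    ofReal_integral_eq_lintegral_ofReal hF (Filter.Eventually.of_forall fun _ => by positivity)]
  refine lintegral_congr fun x => ?_
  rw [ENNReal.rpow_natCast, ENNReal.ofReal_pow (norm_nonneg _), ofReal_norm]

theorem fourier_congr_ae {f g : V → ℂ} (h : f =ᵐ[volume] g) : 𝓕 f = 𝓕 g := by
  ext ξ
  rw [Real.fourier_eq, Real.fourier_eq]
  refine integral_congr_ae ?_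
  filter_upwards [h] with x hx
  rw [hx]

end HausdorffYoung

theorem mainTheorem5 (d : ℕ) (hd : 1 ≤ d) :
    ∃ K : ℝ, 0 < K ∧ ∃ δ₀ : ℝ, 0 < δ₀ ∧
      ∀ q : ℕ, 4 ≤ q → Even q →
      ∀ p : ℝ, (q : ℝ).HolderConjugate p →
      ∀ δ : ℝ, 0 < δ → δ ≤ δ₀ →
      ∀ g : EuclideanSpace ℝ (Fin d) → ℝ,
        AEMeasurable g (volume.restrict (Metric.ball 0 1)) →
        ENNReal.ofReal (1 - δ) * hyConst d q *
            volume (Metric.ball (0 : EuclideanSpace ℝ (Fin d)) 1) ^ (1 / p) ≤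
          eLpNorm (𝓕 ((Metric.ball (0 : EuclideanSpace ℝ (Fin d)) 1).indicator
            fun x => Complex.exp (Complex.I * (g x : ℂ)))) (q : ℝ≥0∞) volume →
        ∃ L : EuclideanSpace ℝ (Fin d) →ᵃ[ℝ] ℝ,
          ∫ x in Metric.ball (0 : EuclideanSpace ℝ (Fin d)) 1,
              ‖Complex.exp (Complex.I * (L x : ℂ) - Complex.I * (g x : ℂ)) - 1‖ ≤
            K * δ ^ (1 / (8 * K)) := by
  obtain ⟨C, hC, H⟩ := exists_affine_phase_of_integral_norm_fourier (EuclideanSpace ℝ (Fin d))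
  -- Taking `K ≥ 1` makes `1 / (8 * K) ≤ 1 / 8`, so for `δ < 1` the required bound is weaker than `C
  -- * δ^{1/8}`.
  refine ⟨max C 1, by positivity, 1 / 2, by norm_num, fun q hq4 hqe p hp δ hδ hδ2 g hg hle => ?_⟩
  obtain ⟨k, rfl⟩ := even_iff_two_dvd.1 hqe
  have hk : k - 1 + 1 = k := by omega
  -- A measurable representative of `g` on the ball changes neither the Fourier transform nor the
  -- final integral.
  set h : EuclideanSpace ℝ (Fin d) → ℂ := fun x => Complex.exp (Complex.I * ((hg.mk g x : ℝ) : ℂ)) with hh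
  have hm : Measurable h := by
    have := hg.measurable_mk
    fun_prop
  have h1 : ∀ x, ‖h x‖ = 1 := fun x => by
    simp only [hh]; rw [mul_comm, Complex.norm_exp_ofReal_mul_I]
  have hae : (Metric.ball (0 : EuclideanSpace ℝ (Fin d)) 1).indicator
      (fun x => Complex.exp (Complex.I * (g x : ℂ))) =ᵐ[volume]
      (Metric.ball (0 : EuclideanSpace ℝ (Fin d)) 1).indicator h := by
    rw [← ae_eq_restrict_iff_indicator_ae_eq measurableSet_ball]
    filter_upwards [hg.ae_eq_mk] with x hx
    rw [hh, hx]
  rw [fourier_congr_ae hae] at hle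
  have i1 := integrable_norm_fourier_pow (integrable_ballInd (V := EuclideanSpace ℝ (Fin d)) 1)
    (norm_ballInd_le 1) (k - 1)
  have i2 := integrable_norm_fourier_pow (integrable_ball_indicator hm h1 1)
    (fun x => (norm_indicator_le h1 _ x).trans (indicator_one_le_one _ x)) (k - 1)
  rw [hk] at i1 i2
  have hpow : (1 - δ) ^ (2 * k) *
      ∫ ξ, ‖𝓕 (ballInd (EuclideanSpace ℝ (Fin d)) 1) ξ‖ ^ (2 * k) ≤
      ∫ ξ, ‖𝓕 ((Metric.ball (0 : EuclideanSpace ℝ (Fin d)) 1).indicator h) ξ‖ ^ (2 * k) := by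
    have h2 := eLpNorm_fourier_le_hyConst_mul (d := d) hp
    rw [ENNReal.ofReal_natCast] at h2
    have h3 := (mul_le_mul_right h2 (ENNReal.ofReal (1 - δ))).trans
      ((mul_assoc _ _ _).symm.le.trans hle)
    have h4 := pow_le_pow_left₀ zero_le h3 (2 * k)
    rw [mul_pow, eLpNorm_pow_eq_ofReal_integral (by omega) i1,
      eLpNorm_pow_eq_ofReal_integral (by omega) i2, ← ENNReal.ofReal_pow (by linarith),
      ← ENNReal.ofReal_mul (pow_nonneg (by linarith) _)] at h4
    exact (ENNReal.ofReal_le_ofReal_iff (integral_nonneg fun _ => by positivity)).1 h4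
  obtain ⟨L, hL⟩ := H k δ h (by omega) hδ hδ2 hm h1 hpow
  refine ⟨L, ?_⟩
  have hint : ∫ x in Metric.ball (0 : EuclideanSpace ℝ (Fin d)) 1,
      ‖Complex.exp (Complex.I * (L x : ℂ) - Complex.I * (g x : ℂ)) - 1‖ =
      ∫ x in Metric.ball (0 : EuclideanSpace ℝ (Fin d)) 1,
        ‖Complex.exp (Complex.I * (L x : ℂ)) - h x‖ := by
    refine integral_congr_ae ?_
    filter_upwards [hg.ae_eq_mk] with x hx
    have e : Complex.exp (Complex.I * (L x : ℂ)) - h x =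
        (Complex.exp (Complex.I * (L x : ℂ) - Complex.I * (g x : ℂ)) - 1) * h x := by
      simp only [hh]
      rw [sub_mul, ← Complex.exp_add, ← hx, sub_add_cancel, one_mul]
    rw [e, norm_mul, h1, mul_one]
  have hLc : Continuous fun x => L x := L.continuous_of_finiteDimensional
  have hLm : Measurable fun x => Complex.exp (Complex.I * (L x : ℂ)) - h x := by
    have := hLc.measurable
    fun_prop
  rw [hint, integral_norm_eq_lintegral_enorm hLm.aestronglyMeasurable]
  refine (ENNReal.toReal_le_of_le_ofReal (by positivity) hL).trans ?_
  have hK : (1 : ℝ) ≤ max C 1 := le_max_right _ _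
  refine mul_le_mul (le_max_left _ _) ?_ (by positivity) (by positivity)
  refine Real.rpow_le_rpow_of_exponent_ge hδ (by linarith) ?_
  exact one_div_le_one_div_of_le (by norm_num) (by linarith)
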